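/- Let $(A,\mathfrak m)$ be a (Noetherian) Cohen–Macaulay local ring of dimension two whose associated graded ring $G(A)=\bigoplus_{n\ge 0}\mathfrak m^n/\mathfrak m^{n+1}$ is Cohen–Macaulay. For an $A$-module $M$ put $G(M)=\bigoplus_{n\ge 0}\mathfrak m^nM/\mathfrak m^{n+1}M$, a graded $G(A)$-module; $G(M)$ is Cohen–Macaulay if its depth (its grade with respect to the homogeneous maximal ideal of $G(A)$) equals its Krull dimension. A maximal Cohen–Macaulay (MCM) module over a local ring $R$ is a nonzero finitely generated module of depth $\dim R$; it is Ulrich if its multiplicity equals its minimal number of generators. (1) Let $B=A/I$ be any one-dimensional Cohen–Macaulay quotient ring of $A$, let $E$ be any Ulrich $B$-module, and let $M=\operatorname{Syz}^A_1(E)$ be the first syzygy of $E$ over $A$, i.e. the kernel of a minimal free cover $A^{\mu(E)}\to E$. Then $M$ is an MCM $A$-module and $G(M)$ is Cohen–Macaulay. If moreover $A$ is not regular, then $M$ is not free. (2) Such $B$ and $E$ exist. In particular there is an MCM $A$-module $M$ with $G(M)$ Cohen–Macaulay, and $M$ can be chosen non-free if $A$ is not regular. -/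

import Mathlib

universe u

open IsLocalRing RingTheory.Sequence

noncomputable section

namespace GradedCM

/-- The depth (grade) of `M` in the ideal `I`: the supremum of the lengths of the `M`-regular
sequences contained in `I`. -/
def depth {R : Type*} [CommRing R] (I : Ideal R) (M : Type*) [AddCommGroup M] [Module R M] : ℕ∞ :=
  ⨆ (rs : List R) (_ : IsRegular M rs) (_ : ∀ r ∈ rs, r ∈ I), (rs.length : ℕ∞)

/-- Cohen-Macaulay local rings: Noetherian local rings whose depth is their dimension. -/
class IsCohenMacaulayLocalRing (A : Type*) [CommRing A] : Prop extends
    IsLocalRing A, IsNoetherianRing A where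
  depth_eq : (depth (maximalIdeal A) A : WithBot ℕ∞) = ringKrullDim A

/-- Maximal Cohen-Macaulay modules over a local ring `A`: nonzero finitely generated modules
whose depth is `dim A`. -/
structure IsMaximalCohenMacaulay (A : Type*) [CommRing A] [IsLocalRing A]
    (M : Type*) [AddCommGroup M] [Module A M] : Prop where
  finite : Module.Finite A M
  nontrivial : Nontrivial M
  depth_eq : (depth (maximalIdeal A) M : WithBot ℕ∞) = ringKrullDim A

/-- `e` is the multiplicity of the module `N` over the local ring `A`, where `𝔪` is the maximal
ideal and `r = dim N`: the length of `N / 𝔪 ^ (n + 1) N` agrees for large `n` with a polynomial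
in `n` of degree `r` with leading coefficient `e / r!`. -/
def HasMultiplicity (A : Type*) [CommRing A] [IsLocalRing A]
    (N : Type*) [AddCommGroup N] [Module A N] (e : ℕ) : Prop :=
  ∃ (r : ℕ) (P : Polynomial ℚ), Module.supportDim A N = r ∧
    (∀ᶠ n : ℕ in Filter.atTop, ∃ l : ℕ,
      Module.length A (N ⧸ (maximalIdeal A ^ (n + 1) • ⊤ : Submodule A N)) = l ∧
      P.eval (n : ℚ) = l) ∧
    P.natDegree = r ∧ P.leadingCoeff * (r.factorial : ℚ) = e

/-- Ulrich modules: maximal Cohen-Macaulay modules whose multiplicity is their minimal number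
of generators. -/
structure IsUlrich (A : Type*) [CommRing A] [IsLocalRing A]
    (U : Type*) [AddCommGroup U] [Module A U] : Prop where
  isMaximalCohenMacaulay : IsMaximalCohenMacaulay A U
  hasMultiplicity : HasMultiplicity A U (⊤ : Submodule A U).spanFinrank

/-- `M` is the first syzygy of `E` over the local ring `A`: it is isomorphic to the kernel of a
minimal free cover `A ^ n → E`. -/
def IsFirstSyzygy (A : Type*) [CommRing A] [IsLocalRing A] (E : Type*) [AddCommGroup E] [Module A E]
    (M : Type*) [AddCommGroup M] [Module A M] : Prop :=
  ∃ (n : ℕ) (ε : (Fin n → A) →ₗ[A] E), Function.Surjective ε ∧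
    LinearMap.ker ε ≤ maximalIdeal A • (⊤ : Submodule A (Fin n → A)) ∧
    Nonempty (M ≃ₗ[A] LinearMap.ker ε)

section AssociatedGraded

variable (A : Type u) [CommRing A] [IsLocalRing A]

/-- The Rees algebra `⨁ 𝔪 ^ n t ^ n` of the maximal ideal `𝔪`, as a subring of `A[t]`. -/
def Rees : Type u := reesAlgebra (maximalIdeal A)

instance : CommRing (Rees A) := inferInstanceAs (CommRing (reesAlgebra (maximalIdeal A)))

instance : Algebra A (Rees A) := inferInstanceAs (Algebra A (reesAlgebra (maximalIdeal A)))

/-- The ideal `⨁_{n ≥ 1} 𝔪 ^ n t ^ n` of the Rees algebra. -/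
def reesPositive : Ideal (Rees A) :=
  RingHom.ker ((Polynomial.constantCoeff (R := A)).comp
    (reesAlgebra (maximalIdeal A)).toSubring.subtype)

/-- The ideal `⨁ 𝔪 ^ (n + 1) t ^ n` of the Rees algebra, i.e. the extension of `𝔪`. -/
def reesMaximal : Ideal (Rees A) := (maximalIdeal A).map (algebraMap A (Rees A))

/-- The associated graded ring `G(A) = ⨁ 𝔪 ^ n / 𝔪 ^ (n + 1)`, as the quotient of the Rees algebra
`⨁ 𝔪 ^ n t ^ n` by its ideal `⨁ 𝔪 ^ (n + 1) t ^ n`. -/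
def AssocGradedRing : Type u := Rees A ⧸ reesMaximal A

instance : CommRing (AssocGradedRing A) := inferInstanceAs (CommRing (Rees A ⧸ reesMaximal A))

/-- The ideal `⨁_{n ≥ 1} 𝔪 ^ n / 𝔪 ^ (n + 1)` of `G(A)`, its only homogeneous maximal ideal. -/
def irrelevant : Ideal (AssocGradedRing A) :=
  (reesPositive A).map (Ideal.Quotient.mk (reesMaximal A))

variable (M : Type u) [AddCommGroup M] [Module A M]

/-- The module `⨁ 𝔪 ^ n M t ^ n` over the Rees algebra, inside `M[t]`. -/
def ReesModule : Type u := ((maximalIdeal A).stableFiltration (⊤ : Submodule A M)).submodule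

instance : AddCommGroup (ReesModule A M) := inferInstanceAs
  (AddCommGroup ((maximalIdeal A).stableFiltration (⊤ : Submodule A M)).submodule)

instance : Module (Rees A) (ReesModule A M) := inferInstanceAs (Module (reesAlgebra (maximalIdeal A))
  ((maximalIdeal A).stableFiltration (⊤ : Submodule A M)).submodule)

/-- The associated graded module `G(M) = ⨁ 𝔪 ^ n M / 𝔪 ^ (n + 1) M` over `G(A)`, as the quotient
of `⨁ 𝔪 ^ n M t ^ n` by its submodule `⨁ 𝔪 ^ (n + 1) M t ^ n`. -/
def AssocGraded : Type u :=
  ReesModule A M ⧸ (reesMaximal A • ⊤ : Submodule (Rees A) (ReesModule A M))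

instance : AddCommGroup (AssocGraded A M) := inferInstanceAs
  (AddCommGroup (ReesModule A M ⧸ (reesMaximal A • ⊤ : Submodule (Rees A) (ReesModule A M))))

instance : Module (AssocGradedRing A) (AssocGraded A M) := inferInstanceAs
  (Module (Rees A ⧸ reesMaximal A)
    (ReesModule A M ⧸ (reesMaximal A • ⊤ : Submodule (Rees A) (ReesModule A M))))

/-- A (finitely generated, graded, nonzero) module over `G(A)` is Cohen-Macaulay if its depth, i.e.
its grade in the homogeneous maximal ideal, is its Krull dimension. -/
def IsGradedCohenMacaulay (N : Type*) [AddCommGroup N] [Module (AssocGradedRing A) N] : Prop :=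
  (depth (irrelevant A) N : WithBot ℕ∞) = Module.supportDim (AssocGradedRing A) N

end AssociatedGraded

end GradedCM

end

/-! Let `M` be the kernel of a minimal cover `F = A^d → E`, so that `M ⊆ 𝔪F`. The Ulrich condition
says that `ℓ(𝔪ⁿE/𝔪ⁿ⁺¹E)` is eventually `μ(E)`. Pass to `S = A[X]` localized at `𝔪A[X]`: this is
faithfully flat, preserves the lengths involved and has infinite residue field, so a regular
superficial element `x` exists. Comparing colengths and applying Nakayama gives `𝔪E = xE` over `S`
(`exists_extension_smul_top_le_range`). Three facts follow and descend to `A`: no nonzero element of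
`G(E)` is killed by all forms of degree one (`mem_pow_smul_top_of_forall_smul_mem`), `M ∩ 𝔪ⁿ⁺¹F =
𝔪ⁿM` (`ker_inf_pow_smul_top_le`), and `ℓ(E/𝔪²E) = 2μ(E)` (`hilbertSamuel_two`).

The second fact makes `0 → G(M)(-1) → G(A)^d → G(E) → 0` exact. Since `G(A)` has depth two and
`G(E)` has positive depth, the depth lemma `exists_isWeaklyRegular_pair_of_exact` produces a regular
pair on `G(M)`. The same lemma applied to `0 → M → F → E` shows that `M` is MCM.

To bound `dim G(M)` by two one needs `dim G(A) = 2`, whereas the hypothesis only equates depth and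
dimension of `G(A)`. This comes from growth (`ringKrullDim_assocGradedRing`): `ℓ(A/𝔪ⁿ)` grows
quadratically, a regular sequence of length three in `G(A)` would force cubic growth, and dimension
at most one would force at most linear growth.

If `M` is free of rank `m`, then `m ≤ d`, and `ℓ(F/𝔪²F) = ℓ(M/𝔪M) + ℓ(E/𝔪²E)` reads `d(1 + μ(𝔪)) = m
+ 2d`. Hence `μ(𝔪) ≤ 2` and `A` is regular.

For existence take `B = A/(x)` with `x` the first term of a regular pair, and `E = 𝔪_B^c` with `c`
so large that the Hilbert function of `B` is constant from degree `c` on: then `ℓ(E/𝔪ᵏE) = k·e` for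
every `k`, and `k = 1` gives `μ(E) = e`. -/

noncomputable section

namespace GradedCM

/-! ### Depth, prime avoidance and a depth lemma. -/

section Depth

open scoped Pointwise

variable {R : Type*} [CommRing R] {N : Type*} [AddCommGroup N] [Module R N]

/-- Prime avoidance: an ideal annihilating no nonzero element of a finite module contains a
regular element. -/
theorem exists_isSMulRegular_of_forall_smul_eq_zero [IsNoetherianRing R] [Module.Finite R N]
    (I : Ideal R) (h : ∀ n : N, (∀ r ∈ I, r • n = 0) → n = 0) : ∃ f ∈ I, IsSMulRegular N f := by
  by_contra! hI
  have hsub : (I : Set R) ⊆ ⋃ p ∈ associatedPrimes R N, (p : Set R) := by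
    rw [biUnion_associatedPrimes_eq_compl_regular]
    exact fun r hr => hI r hr
  obtain ⟨p, hp, hIp⟩ := (Ideal.subset_union_prime_finite (associatedPrimes.finite R N) ⊥ ⊥
    (fun p hp _ _ => IsAssociatedPrime.isPrime hp)).1 hsub
  obtain ⟨hprime, n, rfl⟩ := isAssociatedPrime_iff.1 hp
  have hn : n = 0 := h n fun r hr => by
    simpa [Submodule.mem_colon_singleton] using hIp hr
  exact hprime.ne_top (by simp [hn])

theorem exists_isWeaklyRegular_of_le_depth {I : Ideal R} {n : ℕ} (h : (n : ℕ∞) ≤ depth I N) :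
    ∃ rs : List R, IsWeaklyRegular N rs ∧ (∀ r ∈ rs, r ∈ I) ∧ rs.length = n := by
  rcases Nat.eq_zero_or_pos n with rfl | hn
  · exact ⟨[], by simp⟩
  -- `depth` is a supremum; the strict inequality with `n - 1` yields an actual sequence with at
  -- least `n` terms, which is then truncated.
  have hlt : ((n - 1 : ℕ) : ℕ∞) < depth I N :=
    lt_of_lt_of_le (by exact_mod_cast Nat.sub_lt hn one_pos) h
  simp only [depth, lt_iSup_iff] at hlt
  obtain ⟨rs, hreg, hI, hlen⟩ := hlt
  have hlen : n ≤ rs.length := by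
    have : n - 1 < rs.length := by exact_mod_cast hlen
    omega
  refine ⟨rs.take n, ?_, fun r hr => hI r (List.mem_of_mem_take hr), by simpa using hlen⟩
  have := hreg.toIsWeaklyRegular
  rw [← List.take_append_drop n rs, isWeaklyRegular_append_iff] at this
  exact this.1

theorem le_depth_of_isRegular {I : Ideal R} {rs : List R} (h : IsRegular N rs)
    (hI : ∀ r ∈ rs, r ∈ I) : (rs.length : ℕ∞) ≤ depth I N :=
  le_iSup_of_le rs (le_iSup_of_le h (le_iSup_of_le hI le_rfl))

theorem length_le_supportDim_of_isRegular [IsNoetherianRing R] [Module.Finite R N] {rs : List R}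
    (h : IsRegular N rs) : ((rs.length : ℕ∞) : WithBot ℕ∞) ≤ Module.supportDim R N := by
  induction rs generalizing N with
  | nil =>
    have := h.nontrivial
    obtain ⟨d, hd⟩ := WithBot.ne_bot_iff_exists.1
      (Module.supportDim_ne_bot_of_nontrivial (R := R) (M := N))
    rw [← hd]
    simp
  | cons x rs ih =>
    rw [isRegular_cons_iff] at h
    have h1 := ih h.2
    have h2 := Module.supportDim_quotSMulTop_succ_le_of_notMem_minimalPrimes (R := R) (M := N)
      (x := x) (fun _ ↦ h.1.notMem_of_mem_minimalPrimes)
    refine le_trans ?_ h2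
    simpa using add_le_add_left h1 1

theorem depth_le_supportDim [IsNoetherianRing R] [Module.Finite R N] [Nontrivial N] (I : Ideal R) :
    (depth I N : WithBot ℕ∞) ≤ Module.supportDim R N := by
  obtain ⟨d, hd⟩ := WithBot.ne_bot_iff_exists.1
    (Module.supportDim_ne_bot_of_nontrivial (R := R) (M := N))
  rw [← hd, WithBot.coe_le_coe]
  refine iSup_le fun rs => iSup_le fun h => iSup_le fun _ => ?_
  have := length_le_supportDim_of_isRegular h
  rwa [← hd, WithBot.coe_le_coe] at this

/-- If `a, b` is a weakly regular sequence in `I`, then modulo any other regular element no nonzero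
element is annihilated by `I`. -/
theorem eq_zero_of_smul_eq_zero_quotSMulTop {I : Ideal R} {a b f : R} (ha : a ∈ I) (hb : b ∈ I)
    (hab : IsWeaklyRegular N [a, b]) (hf : IsSMulRegular N f) (n : QuotSMulTop f N)
    (hn : ∀ r ∈ I, r • n = 0) : n = 0 := by
  rw [isWeaklyRegular_cons_iff, isWeaklyRegular_singleton_iff] at hab
  obtain ⟨h1, h2⟩ := hab
  obtain ⟨u, rfl⟩ := Submodule.mkQ_surjective _ n
  have key : ∀ r ∈ I, ∃ w, f • w = r • u := fun r hr => by
    have := hn r hr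
    rw [← map_smul, Submodule.mkQ_apply, Submodule.Quotient.mk_eq_zero,
      Submodule.mem_smul_pointwise_iff_exists] at this
    obtain ⟨w, -, hw⟩ := this
    exact ⟨w, hw⟩
  -- From `au = fv` and `bu = fw` one gets `f(bv) = f(aw)`, so `bv = aw`. Regularity of `b` modulo
  -- `a` gives `v ∈ aN`, and cancelling `a` gives `u ∈ fN`.
  obtain ⟨v, hv⟩ := key a ha
  obtain ⟨w, hw⟩ := key b hb
  have hbv : b • v = a • w := by
    apply hf
    change f • b • v = f • a • w
    rw [smul_comm f b v, hv, smul_comm f a w, hw, smul_comm]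
  have hv0 : Submodule.Quotient.mk (p := a • (⊤ : Submodule R N)) v = 0 := by
    apply h2.right_eq_zero_of_smul
    rw [← Submodule.Quotient.mk_smul, hbv, Submodule.Quotient.mk_eq_zero]
    exact Submodule.smul_mem_pointwise_smul _ _ _ trivial
  rw [Submodule.Quotient.mk_eq_zero, Submodule.mem_smul_pointwise_iff_exists] at hv0
  obtain ⟨v', -, rfl⟩ := hv0
  rw [Submodule.mkQ_apply, Submodule.Quotient.mk_eq_zero]
  have : u = f • v' := by
    apply h1
    change a • u = a • f • v'
    rw [← hv, smul_comm]
  rw [this]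
  exact Submodule.smul_mem_pointwise_smul _ _ _ trivial

/-- A depth lemma: if `0 → L → K → N` is exact, `K` has depth at least two in `I` and `N` depth at
least one, then `L` has a weakly regular sequence of length two in `I`. -/
theorem exists_isWeaklyRegular_pair_of_exact [IsNoetherianRing R] [Module.Finite R N]
    {L K : Type*} [AddCommGroup L] [Module R L] [AddCommGroup K] [Module R K] [Module.Finite R K]
    (ι : L →ₗ[R] K) (π : K →ₗ[R] N) (hι : Function.Injective ι) (hex : Function.Exact ι π)
    {I : Ideal R} {a b : R} (ha : a ∈ I) (hb : b ∈ I) (hab : IsWeaklyRegular K [a, b])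
    (hN : ∀ n : N, (∀ r ∈ I, r • n = 0) → n = 0) :
    ∃ f ∈ I, ∃ g ∈ I, IsWeaklyRegular L [f, g] := by
  have ha' : IsSMulRegular K a := ((isWeaklyRegular_cons_iff _ _ _).1 hab).1
  -- Prime avoidance on the product gives one element regular on both `K` and `N`.
  obtain ⟨f, hfI, hf⟩ := exists_isSMulRegular_of_forall_smul_eq_zero (N := K × N) I (by
    rintro ⟨k, n⟩ h
    have h1 := fun r hr => congrArg Prod.fst (h r hr)
    have h2 := fun r hr => congrArg Prod.snd (h r hr)
    exact Prod.ext (ha'.right_eq_zero_of_smul (h1 a ha)) (hN n h2))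
  have hfK : IsSMulRegular K f := hf.of_injective (LinearMap.inl R K N) LinearMap.inl_injective
  have hfN : IsSMulRegular N f := hf.of_injective (LinearMap.inr R K N) LinearMap.inr_injective
  obtain ⟨g, hgI, hg⟩ := exists_isSMulRegular_of_forall_smul_eq_zero (N := QuotSMulTop f K) I
    (eq_zero_of_smul_eq_zero_quotSMulTop ha hb hab hfK)
  refine ⟨f, hfI, g, hgI, ?_⟩
  rw [isWeaklyRegular_cons_iff, isWeaklyRegular_singleton_iff]
  refine ⟨hfK.of_injective ι hι, hg.of_injective (QuotSMulTop.map f ι) ?_⟩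
  -- Regularity of `f` on `N` keeps `L/fL → K/fK` injective, so `g` may be chosen for `K/fK`.
  rw [injective_iff_map_eq_zero]
  intro z hz
  obtain ⟨l, rfl⟩ := Submodule.mkQ_surjective _ z
  have hz' : ι l ∈ f • (⊤ : Submodule R K) := (Submodule.Quotient.mk_eq_zero _).1 hz
  obtain ⟨k, -, hk⟩ := (Submodule.mem_smul_pointwise_iff_exists _ _ _).1 hz'
  have hπ : π k = 0 := hfN.right_eq_zero_of_smul (by
    rw [← map_smul, show f • k = ι l from hk]; exact hex.apply_apply_eq_zero l)
  obtain ⟨l', rfl⟩ := (hex k).1 hπ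
  have : l = f • l' := hι (by rw [map_smul]; exact hk.symm)
  rw [Submodule.mkQ_apply, Submodule.Quotient.mk_eq_zero, this]
  exact Submodule.smul_mem_pointwise_smul _ _ _ trivial

end Depth

/-! ### Coefficients in Rees algebras and modules; associated graded objects. -/

section AssociatedGradedAPI

variable {A : Type u} [CommRing A] [IsLocalRing A]

namespace Rees

/-- The `n`-th coefficient of an element of the Rees algebra. -/
def coeff (n : ℕ) (r : Rees A) : A := Polynomial.coeff (r : reesAlgebra (maximalIdeal A)).1 n

/-- The element `a t ^ n` of the Rees algebra, for `a ∈ 𝔪 ^ n`. -/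
def monomial (n : ℕ) (a : A) (h : a ∈ maximalIdeal A ^ n) : Rees A :=
  (⟨Polynomial.monomial n a, reesAlgebra.monomial_mem.2 h⟩ : reesAlgebra (maximalIdeal A))

theorem coeff_mem (n : ℕ) (r : Rees A) : coeff n r ∈ maximalIdeal A ^ n :=
  (r : reesAlgebra (maximalIdeal A)).2 n

@[ext] theorem ext {r s : Rees A} (h : ∀ n, coeff n r = coeff n s) : r = s :=
  Subtype.ext (Polynomial.ext h)

@[simp] theorem coeff_zero (n : ℕ) : coeff n (0 : Rees A) = 0 := Polynomial.coeff_zero n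

@[simp] theorem coeff_add (n : ℕ) (r s : Rees A) : coeff n (r + s) = coeff n r + coeff n s :=
  Polynomial.coeff_add _ _ n

@[simp] theorem coeff_sub (n : ℕ) (r s : Rees A) : coeff n (r - s) = coeff n r - coeff n s :=
  Polynomial.coeff_sub _ _ n

theorem coeff_sum {ι : Type*} (n : ℕ) (s : Finset ι) (f : ι → Rees A) :
    coeff n (∑ i ∈ s, f i) = ∑ i ∈ s, coeff n (f i) :=
  map_sum (⟨⟨coeff n, coeff_zero n⟩, coeff_add n⟩ : Rees A →+ A) f s

theorem coeff_mul (n : ℕ) (r s : Rees A) :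
    coeff n (r * s) = ∑ x ∈ Finset.HasAntidiagonal.antidiagonal n, coeff x.1 r * coeff x.2 s :=
  Polynomial.coeff_mul _ _ n

theorem coeff_one (n : ℕ) : coeff n (1 : Rees A) = if n = 0 then 1 else 0 :=
  Polynomial.coeff_one

theorem coeff_monomial (n m : ℕ) (a : A) (h : a ∈ maximalIdeal A ^ n) :
    coeff m (monomial n a h) = if n = m then a else 0 :=
  Polynomial.coeff_monomial

theorem monomial_add (n : ℕ) {x y : A} (hx : x ∈ maximalIdeal A ^ n) (hy : y ∈ maximalIdeal A ^ n) :
    monomial n (x + y) (add_mem hx hy) = monomial n x hx + monomial n y hy := by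
  ext m
  simp only [coeff_monomial, coeff_add]
  split_ifs <;> simp

theorem monomial_succ_mul {n : ℕ} {x y : A} (hx : x ∈ maximalIdeal A)
    (hy : y ∈ maximalIdeal A ^ n) :
    monomial (n + 1) (x * y) (by rw [pow_succ']; exact Ideal.mul_mem_mul hx hy) =
      monomial 1 x (by simpa using hx) * monomial n y hy := by
  apply Subtype.ext
  change Polynomial.monomial _ _ = Polynomial.monomial 1 x * Polynomial.monomial n y
  rw [Polynomial.monomial_mul_monomial, add_comm]

theorem coeff_algebraMap_mul (n : ℕ) (a : A) (r : Rees A) :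
    coeff n (algebraMap A (Rees A) a * r) = a * coeff n r :=
  Polynomial.coeff_C_mul _

theorem exists_forall_coeff_eq_zero (r : Rees A) : ∃ D, ∀ n, D ≤ n → coeff n r = 0 :=
  ⟨(r : reesAlgebra (maximalIdeal A)).1.natDegree + 1, fun _ hn =>
    Polynomial.coeff_eq_zero_of_natDegree_lt (by omega)⟩

theorem eq_sum_monomial {r : Rees A} {D : ℕ} (hD : ∀ n, D ≤ n → coeff n r = 0) :
    r = ∑ n ∈ Finset.range D, monomial n (coeff n r) (coeff_mem n r) := by
  ext m
  rw [coeff_sum]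
  simp only [coeff_monomial, Finset.sum_ite_eq', Finset.mem_range]
  split_ifs with h
  · rfl
  · exact hD m (not_lt.1 h)

instance [IsNoetherianRing A] : IsNoetherianRing (Rees A) :=
  inferInstanceAs (IsNoetherianRing (reesAlgebra (maximalIdeal A)))

end Rees

/-- Since `𝔪ⁿ⁺¹tⁿ = 𝔪·𝔪ⁿtⁿ`, the extension of `𝔪` is detected coefficientwise. Equations in `G(A)`
thereby become membership statements in powers of `𝔪`. -/
theorem mem_reesMaximal {r : Rees A} :
    r ∈ reesMaximal A ↔ ∀ n, r.coeff n ∈ maximalIdeal A ^ (n + 1) := by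
  constructor
  · let J : Ideal (Rees A) :=
      { carrier := {r | ∀ n, r.coeff n ∈ maximalIdeal A ^ (n + 1)}
        add_mem' := fun ha hb n => by
          rw [Rees.coeff_add]; exact add_mem (ha n) (hb n)
        zero_mem' := fun n => by simp
        smul_mem' := fun c x hx n => by
          rw [smul_eq_mul, Rees.coeff_mul]
          refine sum_mem fun y hy => ?_
          rw [← Finset.HasAntidiagonal.mem_antidiagonal.1 hy, add_assoc, pow_add]
          exact Ideal.mul_mem_mul (Rees.coeff_mem _ _) (hx _) }
    have : reesMaximal A ≤ J := Ideal.map_le_iff_le_comap.2 fun a ha n => by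
      have h1 := Rees.coeff_algebraMap_mul n a 1
      rw [mul_one, Rees.coeff_one] at h1
      rw [h1]
      split_ifs with hn
      · simpa [hn] using ha
      · simp
    exact fun hr => this hr
  · intro h
    obtain ⟨D, hD⟩ := r.exists_forall_coeff_eq_zero
    rw [Rees.eq_sum_monomial hD]
    refine sum_mem fun n _ => ?_
    -- The membership proof required by `Rees.monomial` is packed into an existential so that
    -- induction on products and sums can run on the element alone.
    have key : ∀ a ∈ maximalIdeal A ^ (n + 1), ∃ ha : a ∈ maximalIdeal A ^ n,
        Rees.monomial n a ha ∈ reesMaximal A := by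
      intro a ha
      rw [pow_succ'] at ha
      refine Submodule.mul_induction_on ha (fun x hx y hy => ?_) ?_
      · refine ⟨Ideal.mul_mem_left _ _ hy, ?_⟩
        have : Rees.monomial n (x * y) (Ideal.mul_mem_left _ _ hy) =
            algebraMap A (Rees A) x * Rees.monomial n y hy := by
          ext m
          simp [Rees.coeff_algebraMap_mul, Rees.coeff_monomial]
        rw [this]
        exact Ideal.mul_mem_right _ _ (Ideal.mem_map_of_mem _ hx)
      · rintro x y ⟨hx, hx'⟩ ⟨hy, hy'⟩
        refine ⟨add_mem hx hy, ?_⟩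
        rw [Rees.monomial_add n hx hy]
        exact add_mem hx' hy'
    exact (key _ (h n)).2

variable {M : Type u} [AddCommGroup M] [Module A M]

namespace ReesModule

/-- The `n`-th coefficient of an element of the Rees module. -/
def coeff (n : ℕ) (p : ReesModule A M) : M :=
  PolynomialModule.coeff (p : ((maximalIdeal A).stableFiltration (⊤ : Submodule A M)).submodule).1 n

/-- The element `u t ^ n` of the Rees module, for `u ∈ 𝔪 ^ n M`. -/
def single (n : ℕ) (u : M) (h : u ∈ (maximalIdeal A ^ n • ⊤ : Submodule A M)) : ReesModule A M :=
  (⟨PolynomialModule.single A n u, fun m => by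
    rw [PolynomialModule.coeff_single, Finsupp.single_apply]
    split_ifs with hm
    · exact hm ▸ h
    · exact zero_mem _⟩ : ((maximalIdeal A).stableFiltration (⊤ : Submodule A M)).submodule)

theorem coeff_mem (n : ℕ) (p : ReesModule A M) :
    coeff n p ∈ (maximalIdeal A ^ n • ⊤ : Submodule A M) :=
  (p : ((maximalIdeal A).stableFiltration (⊤ : Submodule A M)).submodule).2 n

@[ext] theorem ext {p q : ReesModule A M} (h : ∀ n, coeff n p = coeff n q) : p = q :=
  Subtype.ext (PolynomialModule.ext (Finsupp.ext h))

@[simp] theorem coeff_zero (n : ℕ) : coeff n (0 : ReesModule A M) = 0 := rfl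

@[simp] theorem coeff_add (n : ℕ) (p q : ReesModule A M) :
    coeff n (p + q) = coeff n p + coeff n q := rfl

theorem coeff_sum {ι : Type*} (n : ℕ) (s : Finset ι) (f : ι → ReesModule A M) :
    coeff n (∑ i ∈ s, f i) = ∑ i ∈ s, coeff n (f i) :=
  map_sum (⟨⟨coeff n, coeff_zero n⟩, coeff_add n⟩ : ReesModule A M →+ M) f s

theorem coeff_smul (n : ℕ) (r : Rees A) (p : ReesModule A M) :
    coeff n (r • p) = ∑ x ∈ Finset.HasAntidiagonal.antidiagonal n, r.coeff x.1 • coeff x.2 p :=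
  PolynomialModule.smul_apply _ _ n

theorem coeff_single (n m : ℕ) (u : M) (h : u ∈ (maximalIdeal A ^ n • ⊤ : Submodule A M)) :
    coeff m (single n u h) = if n = m then u else 0 := Finsupp.single_apply

theorem exists_forall_coeff_eq_zero (p : ReesModule A M) : ∃ D, ∀ n, D ≤ n → coeff n p = 0 := by
  let q := PolynomialModule.coeff
    (p : ((maximalIdeal A).stableFiltration (⊤ : Submodule A M)).submodule).1
  obtain ⟨D, hD⟩ := q.support.bddAbove
  refine ⟨D + 1, fun n hn => ?_⟩
  by_contra h
  have := hD (Finsupp.mem_support_iff.2 h : n ∈ q.support)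
  omega

theorem eq_sum_single {p : ReesModule A M} {D : ℕ} (hD : ∀ n, D ≤ n → coeff n p = 0) :
    p = ∑ n ∈ Finset.range D, single n (coeff n p) (coeff_mem n p) := by
  ext m
  rw [coeff_sum]
  simp only [coeff_single, Finset.sum_ite_eq', Finset.mem_range]
  split_ifs with h
  · rfl
  · exact hD m (not_lt.1 h)

theorem coeff_monomial_smul (n m : ℕ) (a : A) (ha : a ∈ maximalIdeal A ^ n) (p : ReesModule A M) :
    coeff m (Rees.monomial n a ha • p) = if n ≤ m then a • coeff (m - n) p else 0 :=
  PolynomialModule.monomial_smul_apply _ _ _ _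

instance [IsNoetherianRing A] [Module.Finite A M] : Module.Finite (Rees A) (ReesModule A M) := by
  have h := ((maximalIdeal A).stableFiltration (⊤ : Submodule A M)).submodule_fg_iff_stable
    (fun i => IsNoetherian.noetherian _)
  exact Module.Finite.iff_fg (R := reesAlgebra (maximalIdeal A)) |>.2 (h.2 ((maximalIdeal A).stableFiltration_stable ⊤))

end ReesModule

theorem mem_reesMaximal_smul_top {p : ReesModule A M} :
    p ∈ (reesMaximal A • ⊤ : Submodule (Rees A) (ReesModule A M)) ↔
      ∀ n, p.coeff n ∈ (maximalIdeal A ^ (n + 1) • ⊤ : Submodule A M) := by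
  constructor
  · intro hp
    refine Submodule.smul_induction_on hp (fun r hr q _ n => ?_) (fun p q h1 h2 n => ?_)
    · rw [ReesModule.coeff_smul]
      refine sum_mem fun x hx => ?_
      rw [← Finset.HasAntidiagonal.mem_antidiagonal.1 hx, show x.1 + x.2 + 1 = (x.1 + 1) + x.2 by omega, pow_add,
        mul_smul]
      exact Submodule.smul_mem_smul (mem_reesMaximal.1 hr _) (ReesModule.coeff_mem _ _)
    · rw [ReesModule.coeff_add]
      exact add_mem (h1 n) (h2 n)
  · intro h
    obtain ⟨D, hD⟩ := p.exists_forall_coeff_eq_zero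
    rw [ReesModule.eq_sum_single hD]
    refine sum_mem fun n _ => ?_
    have key : ∀ u ∈ (maximalIdeal A ^ (n + 1) • ⊤ : Submodule A M),
        ∃ hu : u ∈ (maximalIdeal A ^ n • ⊤ : Submodule A M),
        ReesModule.single n u hu ∈ (reesMaximal A • ⊤ : Submodule (Rees A) (ReesModule A M)) := by
      intro u hu
      rw [pow_succ', mul_smul] at hu
      refine Submodule.smul_induction_on hu (fun a ha v hv => ?_) ?_
      · refine ⟨Submodule.smul_mem _ _ hv, ?_⟩
        have : ReesModule.single n (a • v) (Submodule.smul_mem _ _ hv) =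
            algebraMap A (Rees A) a • ReesModule.single n v hv := by
          ext m
          have : algebraMap A (Rees A) a = Rees.monomial 0 a (by simp) := rfl
          rw [this, ReesModule.coeff_monomial_smul]
          simp [ReesModule.coeff_single]
        rw [this]
        exact Submodule.smul_mem_smul (Ideal.mem_map_of_mem _ ha) trivial
      · rintro x y ⟨hx, hx'⟩ ⟨hy, hy'⟩
        refine ⟨add_mem hx hy, ?_⟩
        have : ReesModule.single n (x + y) (add_mem hx hy) =
            ReesModule.single n x hx + ReesModule.single n y hy := by
          ext m
          simp only [ReesModule.coeff_single, ReesModule.coeff_add]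
          split_ifs <;> simp
        rw [this]
        exact add_mem hx' hy'
    exact (key _ (h n)).2

namespace AssocGradedRing

/-- The projection from the Rees algebra to the associated graded ring. -/
def mk : Rees A →+* AssocGradedRing A := Ideal.Quotient.mk (reesMaximal A)

theorem mk_surjective : Function.Surjective (mk (A := A)) := Ideal.Quotient.mk_surjective

theorem mk_eq_zero {r : Rees A} : mk r = 0 ↔ ∀ n, r.coeff n ∈ maximalIdeal A ^ (n + 1) :=
  Ideal.Quotient.eq_zero_iff_mem.trans mem_reesMaximal

theorem mk_mem_irrelevant {r : Rees A} : mk r ∈ irrelevant A ↔ r.coeff 0 ∈ maximalIdeal A := by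
  have hpos : ∀ {s : Rees A}, s ∈ reesPositive A ↔ s.coeff 0 = 0 := Iff.rfl
  constructor
  · intro h
    obtain ⟨s, hs, hsr⟩ := (Ideal.mem_map_iff_of_surjective _ Ideal.Quotient.mk_surjective).1 h
    have h0 : mk (r - s) = 0 := by
      rw [map_sub, sub_eq_zero]; exact hsr.symm
    have := mk_eq_zero.1 h0 0
    rw [Rees.coeff_sub, hpos.1 hs] at this
    simpa using this
  · intro h
    have h1 : mk r = mk (r - Rees.monomial 0 (r.coeff 0) (by simp)) := by
      rw [map_sub, eq_comm, sub_eq_self, mk_eq_zero]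
      intro n
      rw [Rees.coeff_monomial]
      split_ifs with hn
      · simpa [← hn] using h
      · simp
    rw [h1]
    exact Ideal.mem_map_of_mem _ (hpos.2 (by simp [Rees.coeff_monomial]))

instance [IsNoetherianRing A] : IsNoetherianRing (AssocGradedRing A) :=
  inferInstanceAs (IsNoetherianRing (Rees A ⧸ reesMaximal A))

theorem mk_monomial_mem_irrelevant_pow {n : ℕ} {a : A} (h : a ∈ maximalIdeal A ^ n) :
    mk (Rees.monomial n a h) ∈ irrelevant A ^ n := by
  have key : ∀ n, ∀ a ∈ maximalIdeal A ^ n, ∃ h : a ∈ maximalIdeal A ^ n,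
      mk (Rees.monomial n a h) ∈ irrelevant A ^ n := by
    intro n
    induction n with
    | zero => exact fun a h => ⟨h, by simp⟩
    | succ n ih =>
      intro a ha
      rw [pow_succ'] at ha
      refine Submodule.mul_induction_on ha (fun x hx y hy => ?_) ?_
      · obtain ⟨h1, h2⟩ := ih y hy
        refine ⟨by rw [pow_succ']; exact Ideal.mul_mem_mul hx hy, ?_⟩
        rw [Rees.monomial_succ_mul hx hy, map_mul, pow_succ']
        refine Ideal.mul_mem_mul (mk_mem_irrelevant.2 ?_) h2
        simp [Rees.coeff_monomial]
      · rintro x y ⟨hx, hx'⟩ ⟨hy, hy'⟩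
        refine ⟨add_mem hx hy, ?_⟩
        rw [Rees.monomial_add (n + 1) hx hy, map_add]
        exact add_mem hx' hy'
  exact (key n a h).2

end AssocGradedRing

namespace AssocGraded

/-- The projection from the Rees module to the associated graded module. -/
def mk : ReesModule A M →+ AssocGraded A M :=
  (Submodule.mkQ (reesMaximal A • ⊤ : Submodule (Rees A) (ReesModule A M))).toAddMonoidHom

theorem mk_surjective : Function.Surjective (mk (A := A) (M := M)) := Submodule.mkQ_surjective _

theorem mk_eq_zero {p : ReesModule A M} :
    mk p = 0 ↔ ∀ n, p.coeff n ∈ (maximalIdeal A ^ (n + 1) • ⊤ : Submodule A M) :=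
  (Submodule.Quotient.mk_eq_zero _).trans mem_reesMaximal_smul_top

theorem mk_smul_mk (r : Rees A) (p : ReesModule A M) :
    AssocGradedRing.mk r • mk p = mk (r • p) := rfl

instance [IsNoetherianRing A] [Module.Finite A M] :
    Module.Finite (AssocGradedRing A) (AssocGraded A M) := by
  obtain ⟨s, hs⟩ := (inferInstance : Module.Finite (Rees A) (ReesModule A M)).fg_top
  classical
  refine ⟨⟨s.image mk, eq_top_iff.2 fun z _ => ?_⟩⟩
  obtain ⟨p, rfl⟩ := mk_surjective z
  have hp : p ∈ Submodule.span (Rees A) (s : Set (ReesModule A M)) := hs ▸ trivial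
  induction hp using Submodule.span_induction with
  | mem x hx => exact Submodule.subset_span (by simpa using ⟨x, hx, rfl⟩)
  | zero => rw [map_zero]; exact zero_mem _
  | add x y _ _ hx hy => rw [map_add]; exact add_mem (hx trivial) (hy trivial)
  | smul r x _ hx => rw [← mk_smul_mk]; exact Submodule.smul_mem _ _ (hx trivial)

end AssocGraded

end AssociatedGradedAPI

/-! ### Superficial elements and first differences of Hilbert–Samuel functions. -/

section Superficial

variable {A : Type u} [CommRing A] [IsLocalRing A]

/-- Over an infinite residue field, finitely many primes of the associated graded ring that do not
contain the irrelevant ideal are avoided by an element of degree one. -/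
theorem exists_monomial_one_notMem [Infinite (ResidueField A)]
    {S : Set (Ideal (AssocGradedRing A))} (hS : S.Finite) (hirr : ∀ P ∈ S, ¬ irrelevant A ≤ P) :
    ∃ x, ∃ hx : x ∈ maximalIdeal A ^ 1,
      ∀ P ∈ S, AssocGradedRing.mk (Rees.monomial 1 x hx) ∉ P := by
  have hmem : ∀ a : maximalIdeal A, (a : A) ∈ maximalIdeal A ^ 1 := fun a => by simp
  let θ : maximalIdeal A → AssocGradedRing A := fun a =>
    AssocGradedRing.mk (Rees.monomial 1 a (hmem a))
  have θ_add : ∀ a b, θ (a + b) = θ a + θ b := fun a b => by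
    rw [← map_add, ← Rees.monomial_add]; rfl
  have θ_smul : ∀ (r : A) a, θ (r • a) = AssocGradedRing.mk (algebraMap A (Rees A) r) * θ a :=
    fun r a => by
      rw [← map_mul]
      refine congrArg AssocGradedRing.mk (Rees.ext fun m => ?_)
      simp [Rees.coeff_algebraMap_mul, Rees.coeff_monomial]
  have θ_congr : ∀ a b, (maximalIdeal A).toCotangent a = (maximalIdeal A).toCotangent b →
      θ a = θ b := fun a b h => by
    rw [Ideal.toCotangent_eq] at h
    rw [← sub_eq_zero, ← map_sub, AssocGradedRing.mk_eq_zero]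
    intro n
    rw [Rees.coeff_sub, Rees.coeff_monomial, Rees.coeff_monomial]
    split_ifs with hn
    · subst hn; exact h
    · simp
  -- The trace of `P` on the degree one part `𝔪/𝔪²` of `G(A)`. It is a proper subspace because
  -- degree one generates the irrelevant ideal, and a vector space over an infinite field is not a
  -- finite union of proper subspaces.
  let V : Ideal (AssocGradedRing A) → Submodule (ResidueField A) (CotangentSpace A) := fun P =>
    { carrier := {v | ∀ a, (maximalIdeal A).toCotangent a = v → θ a ∈ P}
      add_mem' := fun {v w} hv hw a ha => by
        obtain ⟨b, rfl⟩ := (maximalIdeal A).toCotangent_surjective v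
        obtain ⟨c, rfl⟩ := (maximalIdeal A).toCotangent_surjective w
        rw [θ_congr a (b + c) (by rw [ha, map_add]), θ_add]
        exact add_mem (hv b rfl) (hw c rfl)
      zero_mem' := fun a ha => by
        have : θ a = 0 := by
          rw [θ_congr a ((0 : A) • a) (by rw [ha, zero_smul, map_zero]), θ_smul]
          simp
        rw [this]; exact zero_mem _
      smul_mem' := fun c v hv a ha => by
        obtain ⟨b, rfl⟩ := (maximalIdeal A).toCotangent_surjective v
        obtain ⟨r, rfl⟩ := residue_surjective c
        rw [θ_congr a (r • b) (by rw [ha, map_smul]; rfl), θ_smul]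
        exact Ideal.mul_mem_left _ _ (hv b rfl) }
  have hV : ∀ P ∈ S, V P ≠ ⊤ := fun P hP htop => by
    apply hirr P hP
    have h1 : ∀ a, θ a ∈ P := fun a => by
      have : (maximalIdeal A).toCotangent a ∈ V P := htop ▸ trivial
      exact this a rfl
    intro z hz
    obtain ⟨r, rfl⟩ := AssocGradedRing.mk_surjective z
    rw [AssocGradedRing.mk_mem_irrelevant] at hz
    obtain ⟨D, hD⟩ := r.exists_forall_coeff_eq_zero
    rw [Rees.eq_sum_monomial hD, map_sum]
    refine sum_mem fun n _ => ?_
    rcases n with _ | n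
    · convert zero_mem P
      rw [AssocGradedRing.mk_eq_zero]
      intro n
      rw [Rees.coeff_monomial]
      split_ifs with hn
      · subst hn; simpa using hz
      · simp
    · have key : ∀ a ∈ maximalIdeal A ^ (n + 1), ∃ h : a ∈ maximalIdeal A ^ (n + 1),
          AssocGradedRing.mk (Rees.monomial (n + 1) a h) ∈ P := by
        intro a ha
        rw [pow_succ'] at ha
        refine Submodule.mul_induction_on ha (fun x hx y hy => ?_) ?_
        · refine ⟨by rw [pow_succ']; exact Ideal.mul_mem_mul hx hy, ?_⟩
          rw [Rees.monomial_succ_mul hx hy, map_mul]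
          exact Ideal.mul_mem_right _ _ (h1 ⟨x, hx⟩)
        · rintro x y ⟨hx, hx'⟩ ⟨hy, hy'⟩
          refine ⟨add_mem hx hy, ?_⟩
          rw [Rees.monomial_add (n + 1) hx hy, map_add]
          exact add_mem hx' hy'
      exact (key _ (r.coeff_mem _)).2
  have hcov := Subspace.biUnion_ne_univ_of_top_notMem (s := (hS.image V).toFinset) (by
    simp only [Set.Finite.mem_toFinset, Set.mem_image, not_exists, not_and]
    exact hV)
  obtain ⟨v, hv⟩ := (Set.ne_univ_iff_exists_notMem _).1 hcov
  obtain ⟨a, rfl⟩ := (maximalIdeal A).toCotangent_surjective v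
  refine ⟨a, hmem a, fun P hP hmemP => hv ?_⟩
  simp only [Set.mem_iUnion, Set.Finite.mem_toFinset, Set.mem_image]
  refine ⟨V P, ⟨P, hP, rfl⟩, fun b hb => ?_⟩
  rw [θ_congr b a hb]
  exact hmemP

variable {E : Type u} [AddCommGroup E] [Module A E]

/-- Existence of elements that are superficial in large degrees. -/
theorem exists_superficial [IsNoetherianRing A] [Infinite (ResidueField A)] [Module.Finite A E] :
    ∃ x ∈ maximalIdeal A, ∃ c, ∀ n ≥ c, ∀ u ∈ (maximalIdeal A ^ n • ⊤ : Submodule A E),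
      x • u ∈ (maximalIdeal A ^ (n + 2) • ⊤ : Submodule A E) →
      u ∈ (maximalIdeal A ^ (n + 1) • ⊤ : Submodule A E) := by
  let N := AssocGraded A E
  let S : Set (Ideal (AssocGradedRing A)) :=
    {P ∈ associatedPrimes (AssocGradedRing A) N | ¬ irrelevant A ≤ P}
  obtain ⟨x, hx, hxS⟩ := exists_monomial_one_notMem (S := S)
    ((associatedPrimes.finite _ _).subset (Set.sep_subset _ _)) (fun P hP => hP.2)
  set g := AssocGradedRing.mk (Rees.monomial 1 x hx)
  let K := Submodule.torsionBy (AssocGradedRing A) N g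
  -- A minimal prime over the annihilator of the kernel `K` of `g` is associated to `G(E)` and
  -- contains `g`; by the choice of `x` it contains the irrelevant ideal.
  have hrad : irrelevant A ≤ (Module.annihilator (AssocGradedRing A) K).radical := by
    rw [← Ideal.sInf_minimalPrimes]
    refine le_sInf fun P hP => ?_
    have hPass := Module.associatedPrimes.minimalPrimes_annihilator_subset_associatedPrimes _ _ hP
    have hPN : IsAssociatedPrime P N := IsAssociatedPrime.map_of_injective K.subtype hPass
      K.injective_subtype
    by_contra hirr
    refine hxS P ⟨hPN, hirr⟩ (hP.1.2 ?_)
    rw [Module.mem_annihilator]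
    exact fun k => Subtype.ext ((Submodule.mem_torsionBy_iff _ _).1 k.2)
  obtain ⟨c, hc⟩ := Ideal.exists_pow_le_of_le_radical_of_fg hrad (IsNoetherian.noetherian _)
  have hx' : x ∈ maximalIdeal A := by simpa using hx
  -- The elements whose initial forms lie in `K`. By Artin–Rees this filtration is stable, so far
  -- out its `n`-th term is `𝔪ᶜ` times the `(n-c)`-th. As the `c`-th power of the irrelevant ideal
  -- kills `K`, that term lies in `𝔪ⁿ⁺¹E`.
  let F : (maximalIdeal A).Filtration E :=
    { N := fun n => (maximalIdeal A ^ n • ⊤ : Submodule A E) ⊓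
        ((maximalIdeal A ^ (n + 2) • ⊤ : Submodule A E).comap (LinearMap.lsmul A E x))
      mono := fun n u hu => by
        refine ⟨Submodule.smul_mono_left (Ideal.pow_le_pow_right (by omega)) hu.1, ?_⟩
        exact Submodule.smul_mono_left (Ideal.pow_le_pow_right (by omega)) hu.2
      smul_le := fun n => Submodule.smul_le.2 fun a ha u hu => by
        refine ⟨?_, ?_⟩
        · rw [pow_succ', mul_smul]; exact Submodule.smul_mem_smul ha hu.1
        · change x • a • u ∈ (maximalIdeal A ^ (n + 2 + 1) • ⊤ : Submodule A E)
          rw [smul_comm, pow_succ', mul_smul]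
          exact Submodule.smul_mem_smul ha hu.2 }
  obtain ⟨n₀, hn₀⟩ := ((maximalIdeal A).stableFiltration_stable (⊤ : Submodule A E)).of_le
    (F' := F) (fun n => inf_le_left) |>.exists_pow_smul_eq_of_ge
  refine ⟨x, hx', n₀ + c, fun n hn u hu hxu => ?_⟩
  have hu' : u ∈ F.N n := ⟨hu, hxu⟩
  have hstep : F.N n = maximalIdeal A ^ c • F.N (n - c) := by
    rw [hn₀ n (by omega), hn₀ (n - c) (by omega), ← mul_smul, ← pow_add]
    congr 2; omega
  rw [hstep] at hu'
  refine Submodule.smul_le.2 (fun a ha v hv => ?_) hu'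
  have hvK : AssocGraded.mk (ReesModule.single (n - c) v hv.1) ∈ K := by
    rw [Submodule.mem_torsionBy_iff, AssocGraded.mk_smul_mk, AssocGraded.mk_eq_zero]
    intro m
    rw [ReesModule.coeff_monomial_smul, ReesModule.coeff_single]
    split_ifs with h1 h2
    · have : m + 1 = n - c + 2 := by omega
      rw [this]; exact hv.2
    · simp
    · simp
  have h0 := Module.mem_annihilator.1 (hc (AssocGradedRing.mk_monomial_mem_irrelevant_pow ha))
    ⟨_, hvK⟩
  have h0' : AssocGradedRing.mk (Rees.monomial c a ha) •
    AssocGraded.mk (ReesModule.single (n - c) v hv.1) = 0 := congrArg Subtype.val h0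
  rw [AssocGraded.mk_smul_mk, AssocGraded.mk_eq_zero] at h0'
  have h3 := h0' n
  rw [ReesModule.coeff_monomial_smul, if_pos (by omega), ReesModule.coeff_single, if_pos rfl] at h3
  exact h3

/-- Existence of regular superficial elements. -/
theorem exists_isSMulRegular_superficial [IsNoetherianRing A] [Infinite (ResidueField A)]
    [Module.Finite A E] {y : A} (hy : y ∈ maximalIdeal A) (hyE : IsSMulRegular E y) :
    ∃ x ∈ maximalIdeal A, IsSMulRegular E x ∧ ∃ c, ∀ n ≥ c, ∀ u : E,
      x • u ∈ (maximalIdeal A ^ (n + 1) • ⊤ : Submodule A E) →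
      u ∈ (maximalIdeal A ^ n • ⊤ : Submodule A E) := by
  obtain ⟨x, hx, c, hc⟩ := exists_superficial (A := A) (E := E)
  have hreg : IsSMulRegular E x := by
    rw [isSMulRegular_iff_right_eq_zero_of_smul]
    intro u hu
    -- If `xu = 0`, the multiple `y^c u` starts in the range where `x` is superficial and climbs
    -- through all powers of `𝔪`; Krull's intersection theorem kills it.
    have h1 : ∀ n, y ^ c • u ∈ (maximalIdeal A ^ (c + n) • ⊤ : Submodule A E) := by
      intro n
      induction n with
      | zero => exact Submodule.smul_mem_smul (Ideal.pow_mem_pow hy c) trivial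
      | succ n ih =>
        refine hc (c + n) (by omega) _ ih ?_
        rw [smul_comm, hu, smul_zero]
        exact zero_mem _
    have h2 : y ^ c • u ∈ (⨅ i : ℕ, maximalIdeal A ^ i • ⊤ : Submodule A E) := by
      rw [Submodule.mem_iInf]
      exact fun i => Submodule.smul_mono_left (Ideal.pow_le_pow_right (by omega)) (h1 i)
    rw [Ideal.iInf_pow_smul_eq_bot_of_isLocalRing _ (maximalIdeal.isMaximal A).ne_top] at h2
    exact (hyE.pow c).right_eq_zero_of_smul h2
  -- Artin–Rees for `xE ⊆ E` first places `u` in `𝔪ᶜE`; superficiality then raises the exponent one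
  -- step at a time up to `n`.
  obtain ⟨k, hk⟩ := (maximalIdeal A).exists_pow_inf_eq_pow_smul
    (LinearMap.range (LinearMap.lsmul A E x))
  refine ⟨x, hx, hreg, k + c, fun n hn u hu => ?_⟩
  have h1 : x • u ∈ maximalIdeal A ^ (n + 1 - k) • LinearMap.range (LinearMap.lsmul A E x) := by
    have : x • u ∈ (maximalIdeal A ^ (n + 1) • ⊤ : Submodule A E) ⊓
      LinearMap.range (LinearMap.lsmul A E x) := ⟨hu, ⟨u, rfl⟩⟩
    rw [hk (n + 1) (by omega)] at this
    exact Submodule.smul_mono le_rfl inf_le_right this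
  rw [LinearMap.range_eq_map, ← Submodule.map_smul''] at h1
  obtain ⟨v, hv, hvu⟩ := h1
  have hvu : v = u := hreg hvu
  subst hvu
  have h2 : ∀ j, c + j ≤ n → v ∈ (maximalIdeal A ^ (c + j) • ⊤ : Submodule A E) := by
    intro j
    induction j with
    | zero =>
      exact fun _ => Submodule.smul_mono_left (Ideal.pow_le_pow_right (by omega)) hv
    | succ j ih =>
      intro hj
      refine hc (c + j) (by omega) v (ih (by omega)) ?_
      exact Submodule.smul_mono_left (Ideal.pow_le_pow_right (by omega)) hu
  have := h2 (n - c) (by omega)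
  rwa [show c + (n - c) = n by omega] at this

/-- The length of `E / 𝔪 ^ n E`. -/
def hilbertSamuel (A : Type*) [CommRing A] [IsLocalRing A] (E : Type*) [AddCommGroup E] [Module A E]
    (n : ℕ) : ℕ∞ :=
  Module.length A (E ⧸ (maximalIdeal A ^ n • ⊤ : Submodule A E))

/-- The hypothesis is exactly the injectivity of multiplication by `x` from `E/𝔪ⁿE` to `E/𝔪ⁿ⁺¹E`,
whose cokernel is the last term. -/
theorem hilbertSamuel_succ {A : Type*} [CommRing A] [IsLocalRing A] {E : Type*} [AddCommGroup E]
    [Module A E] {x : A} (hx : x ∈ maximalIdeal A) {n : ℕ}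
    (h : ∀ u : E, x • u ∈ (maximalIdeal A ^ (n + 1) • ⊤ : Submodule A E) →
      u ∈ (maximalIdeal A ^ n • ⊤ : Submodule A E)) :
    hilbertSamuel A E (n + 1) = hilbertSamuel A E n + Module.length A
      (E ⧸ (LinearMap.range (LinearMap.lsmul A E x) ⊔ (maximalIdeal A ^ (n + 1) • ⊤))) := by
  let f : (E ⧸ (maximalIdeal A ^ n • ⊤ : Submodule A E)) →ₗ[A]
      E ⧸ (maximalIdeal A ^ (n + 1) • ⊤ : Submodule A E) :=
    Submodule.mapQ _ _ (LinearMap.lsmul A E x) (fun u hu => by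
      rw [Submodule.mem_comap, pow_succ', mul_smul]
      exact Submodule.smul_mem_smul hx hu)
  let g : (E ⧸ (maximalIdeal A ^ (n + 1) • ⊤ : Submodule A E)) →ₗ[A]
      E ⧸ (LinearMap.range (LinearMap.lsmul A E x) ⊔ (maximalIdeal A ^ (n + 1) • ⊤)) :=
    Submodule.factor le_sup_right
  refine Module.length_eq_add_of_exact f g ?_ (Submodule.factor_surjective _) ?_
  · rw [injective_iff_map_eq_zero]
    intro z hz
    obtain ⟨u, rfl⟩ := Submodule.mkQ_surjective _ z
    have hz' : x • u ∈ (maximalIdeal A ^ (n + 1) • ⊤ : Submodule A E) :=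
      (Submodule.Quotient.mk_eq_zero _).1 hz
    exact (Submodule.Quotient.mk_eq_zero _).2 (h u hz')
  · intro z
    obtain ⟨u, rfl⟩ := Submodule.mkQ_surjective _ z
    constructor
    · intro hz
      have hz' : u ∈ LinearMap.range (LinearMap.lsmul A E x) ⊔ (maximalIdeal A ^ (n + 1) • ⊤) :=
        (Submodule.Quotient.mk_eq_zero _).1 hz
      obtain ⟨_, ⟨v, rfl⟩, w, hw, rfl⟩ := Submodule.mem_sup.1 hz'
      refine ⟨Submodule.mkQ _ v, ?_⟩
      have hw' : (maximalIdeal A ^ (n + 1) • ⊤ : Submodule A E).mkQ w = 0 :=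
        (Submodule.Quotient.mk_eq_zero _).2 hw
      rw [map_add, hw', add_zero]
      rfl
    · rintro ⟨v, hv⟩
      obtain ⟨v, rfl⟩ := Submodule.mkQ_surjective _ v
      rw [← hv]
      exact (Submodule.Quotient.mk_eq_zero _).2 (Submodule.mem_sup_left ⟨v, rfl⟩)

end Superficial

/-! ### Faithfully flat base change, lengths and infinite residue fields. -/

section BaseChange

open scoped TensorProduct

variable {A : Type*} [CommRing A] {S : Type*} [CommRing S] [Algebra A S]
  {E : Type*} [AddCommGroup E] [Module A E]

theorem ker_baseChange_of_surjective {F : Type*} [AddCommGroup F] [Module A F] (ε : F →ₗ[A] E)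
    (hε : Function.Surjective ε) :
    LinearMap.ker (ε.baseChange S) = (LinearMap.ker ε).baseChange S := by
  have h := lTensor_exact S (LinearMap.exact_subtype_ker_map ε) hε
  ext z
  exact h z

theorem baseChange_smul_eq (I : Ideal A) (N : Submodule A E) :
    (I • N).baseChange S = I.map (algebraMap A S) • N.baseChange S := by
  apply le_antisymm
  · rw [Submodule.baseChange_eq_span, Submodule.span_le]
    rintro _ ⟨u, hu, rfl⟩
    refine Submodule.smul_induction_on hu (fun a ha v hv => ?_) (fun x y hx hy => ?_)
    · change (1 : S) ⊗ₜ[A] (a • v) ∈ _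
      rw [TensorProduct.tmul_smul, ← algebraMap_smul S a]
      exact Submodule.smul_mem_smul (Ideal.mem_map_of_mem _ ha)
        (Submodule.tmul_mem_baseChange_of_mem _ hv)
    · rw [map_add]
      exact add_mem hx hy
  · rw [Ideal.map, Submodule.baseChange_eq_span, Submodule.span_smul_span, Submodule.span_le]
    rintro _ ⟨_, ⟨a, ha, rfl⟩, _, ⟨v, hv, rfl⟩, rfl⟩
    change algebraMap A S a • ((1 : S) ⊗ₜ[A] v) ∈ _
    rw [algebraMap_smul, ← TensorProduct.tmul_smul]
    exact Submodule.tmul_mem_baseChange_of_mem _ (Submodule.smul_mem_smul ha hv)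

theorem baseChange_pow_smul_top (I : Ideal A) (n : ℕ) :
    (I ^ n • ⊤ : Submodule A E).baseChange S = (I.map (algebraMap A S)) ^ n • ⊤ := by
  rw [baseChange_smul_eq, Submodule.baseChange_top, Ideal.map_pow]

/-- Faithful flatness is applied to the class of `u` in `E/N`. Through this lemma, memberships
proved over `S` descend to `A`. -/
theorem one_tmul_mem_baseChange [Module.FaithfullyFlat A S] {N : Submodule A E} {u : E} :
    (1 : S) ⊗ₜ[A] u ∈ N.baseChange S ↔ u ∈ N := by
  refine ⟨fun h => ?_, Submodule.tmul_mem_baseChange_of_mem _⟩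
  have h2 := ker_baseChange_of_surjective (S := S) N.mkQ N.mkQ_surjective
  rw [Submodule.ker_mkQ] at h2
  rw [← h2, LinearMap.mem_ker, LinearMap.baseChange_tmul] at h
  have := (Module.FaithfullyFlat.one_tmul_eq_zero_iff A _ (N.mkQ u)).1 h
  exact (Submodule.Quotient.mk_eq_zero _).1 this

/-- Base change of a quotient module. -/
def tensorQuotientEquiv (N : Submodule A E) :
    (S ⊗[A] (E ⧸ N)) ≃ₗ[S] (S ⊗[A] E) ⧸ N.baseChange S :=
  (Submodule.quotEquivOfEq _ _ (by
      rw [ker_baseChange_of_surjective _ N.mkQ_surjective, Submodule.ker_mkQ]) ≪≫ₗ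
    LinearMap.quotKerEquivOfSurjective (N.mkQ.baseChange S)
      (LinearMap.baseChange_surjective S N.mkQ_surjective)).symm

/-- Flatness preserves a composition series, and each simple factor `A/𝔪` becomes `S/𝔪S`, the
residue field of `S`. -/
theorem length_tensorProduct_of_isFiniteLength [IsLocalRing A] [IsLocalRing S] [Module.Flat A S]
    (hS : (maximalIdeal A).map (algebraMap A S) = maximalIdeal S) (hE : IsFiniteLength A E) :
    Module.length S (S ⊗[A] E) = Module.length A E := by
  induction hE with
  | of_subsingleton => simp [Module.length_eq_zero]
  | @of_simple_quotient E _ _ N hN _ ih =>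
    rw [Module.length_eq_add_of_exact N.subtype N.mkQ N.injective_subtype N.mkQ_surjective
        (LinearMap.exact_subtype_mkQ N),
      Module.length_eq_add_of_exact (N.subtype.baseChange S) (N.mkQ.baseChange S)
        (Module.Flat.lTensor_preserves_injective_linearMap _ N.injective_subtype)
        (LinearMap.baseChange_surjective S N.mkQ_surjective)
        (lTensor_exact S (LinearMap.exact_subtype_mkQ N) N.mkQ_surjective), ih,
      Module.length_eq_one A (E ⧸ N)]
    congr 1
    obtain ⟨J, hJ, ⟨e⟩⟩ := isSimpleModule_iff_quot_maximal.1 hN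
    obtain rfl := eq_maximalIdeal hJ
    have e1 : (S ⊗[A] (E ⧸ N)) ≃ₗ[S] S ⊗[A] (A ⧸ maximalIdeal A) := LinearEquiv.baseChange A S _ _ e
    have h2 : ((maximalIdeal A).baseChange S).map
        (TensorProduct.AlgebraTensorModule.rid A S S : S ⊗[A] A →ₗ[S] S) = maximalIdeal S := by
      rw [Submodule.baseChange_eq_span, Submodule.map_span, ← hS, Ideal.map]
      congr 1
      ext z
      constructor
      · rintro ⟨_, ⟨a, ha, rfl⟩, rfl⟩
        exact ⟨a, ha, by simp [Algebra.algebraMap_eq_smul_one]⟩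
      · rintro ⟨a, ha, rfl⟩
        exact ⟨_, ⟨a, ha, rfl⟩, by simp [Algebra.algebraMap_eq_smul_one]⟩
    have e2 : (S ⊗[A] (E ⧸ N)) ≃ₗ[S] S ⧸ maximalIdeal S :=
      e1 ≪≫ₗ tensorQuotientEquiv _ ≪≫ₗ Submodule.Quotient.equiv _ _
        (TensorProduct.AlgebraTensorModule.rid A S S) h2
    rw [e2.length_eq, Module.length_eq_one_iff]
    exact isSimpleModule_iff_quot_maximal.2 ⟨_, inferInstance, ⟨.refl _ _⟩⟩

theorem isFiniteLength_quotient_pow_smul_top [IsLocalRing A] [IsNoetherianRing A] [Module.Finite A E]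
    (n : ℕ) : IsFiniteLength A (E ⧸ (maximalIdeal A ^ n • ⊤ : Submodule A E)) := by
  rcases Nat.eq_zero_or_pos n with rfl | hn
  · have : Subsingleton (E ⧸ (maximalIdeal A ^ 0 • ⊤ : Submodule A E)) :=
      Submodule.Quotient.subsingleton_iff.2 (by simp)
    exact .of_subsingleton
  have hlt : maximalIdeal A ^ n ≠ ⊤ :=
    ne_top_of_le_ne_top (maximalIdeal.isMaximal A).ne_top (Ideal.pow_le_self hn.ne')
  have : Nontrivial (A ⧸ maximalIdeal A ^ n) := Ideal.Quotient.nontrivial_iff.2 hlt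
  have : IsLocalRing (A ⧸ maximalIdeal A ^ n) :=
    .of_surjective' (Ideal.Quotient.mk _) Ideal.Quotient.mk_surjective
  have : IsArtinianRing (A ⧸ maximalIdeal A ^ n) := by
    rw [isArtinianRing_iff_isNilpotent_maximalIdeal]
    refine ⟨n, ?_⟩
    rw [← map_maximalIdeal_of_surjective (Ideal.Quotient.mk (maximalIdeal A ^ n))
      Ideal.Quotient.mk_surjective, ← Ideal.map_pow, Ideal.map_quotient_self]
    rfl
  have : Module.Finite (A ⧸ maximalIdeal A ^ n) (E ⧸ (maximalIdeal A ^ n • ⊤ : Submodule A E)) :=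
    Module.Finite.of_restrictScalars_finite A _ _
  rw [← Module.length_ne_top_iff, Module.length_eq_of_surjective
    (R := A ⧸ maximalIdeal A ^ n) Ideal.Quotient.mk_surjective]
  exact Module.length_ne_top

theorem hilbertSamuel_ne_top [IsLocalRing A] [IsNoetherianRing A] [Module.Finite A E] (n : ℕ) :
    hilbertSamuel A E n ≠ ⊤ :=
  Module.length_ne_top_iff.2 (isFiniteLength_quotient_pow_smul_top n)

theorem hilbertSamuel_tensorProduct [IsLocalRing A] [IsNoetherianRing A] [Module.Finite A E]
    [IsLocalRing S] [Module.Flat A S]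
    (hS : (maximalIdeal A).map (algebraMap A S) = maximalIdeal S) (n : ℕ) :
    hilbertSamuel S (S ⊗[A] E) n = hilbertSamuel A E n := by
  rw [hilbertSamuel, hilbertSamuel,
    ← length_tensorProduct_of_isFiniteLength hS (isFiniteLength_quotient_pow_smul_top n),
    (tensorQuotientEquiv (S := S) (maximalIdeal A ^ n • ⊤ : Submodule A E)).length_eq,
    baseChange_pow_smul_top, hS]

theorem isSMulRegular_tensorProduct [Module.Flat A S] {y : A} (hy : IsSMulRegular E y) :
    IsSMulRegular (S ⊗[A] E) (algebraMap A S y) := by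
  have := (IsWeaklyRegular.isWeaklyRegular_lTensor (M₂ := S)
    ((isWeaklyRegular_singleton_iff E y).2 hy))
  rw [isWeaklyRegular_singleton_iff] at this
  intro u v huv
  apply this
  simpa [algebraMap_smul] using huv

end BaseChange

/-- A Noetherian local ring `A` has a faithfully flat local extension with infinite residue field
whose maximal ideal is extended from `A`, namely `A[X]` localized at `𝔪 A[X]`. -/
theorem exists_faithfullyFlat_infinite_residueField (A : Type u) [CommRing A] [IsLocalRing A]
    [IsNoetherianRing A] :
    ∃ (S : Type u) (_ : CommRing S) (_ : IsLocalRing S) (_ : IsNoetherianRing S) (_ : Algebra A S)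
      (_ : Module.FaithfullyFlat A S),
      (maximalIdeal A).map (algebraMap A S) = maximalIdeal S ∧ Infinite (ResidueField S) := by
  let P : Ideal (Polynomial A) := (maximalIdeal A).map Polynomial.C
  have hP : P.IsPrime := Ideal.isPrime_map_C_of_isPrime
  let S := Localization.AtPrime P
  have hmap : (maximalIdeal A).map (algebraMap A S) = maximalIdeal S := by
    rw [IsScalarTower.algebraMap_eq A (Polynomial A) S, ← Ideal.map_map,
      ← Localization.AtPrime.map_eq_maximalIdeal]
    rfl
  have hflat : Module.Flat A S := Module.Flat.trans A (Polynomial A) S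
  have hloc : IsLocalHom (algebraMap A S) :=
    ((IsLocalRing.local_hom_TFAE (algebraMap A S)).out 0 2).mpr hmap.le
  refine ⟨S, inferInstance, inferInstance, IsLocalization.isNoetherianRing P.primeCompl S
    inferInstance, inferInstance, Module.FaithfullyFlat.of_flat_of_isLocalHom, hmap, ?_⟩
  -- The powers of `X` stay distinct in the residue field, because `X^i - X^j` has a unit
  -- coefficient when `i ≠ j`.
  refine Infinite.of_injective
    (fun n : ℕ => residue S (algebraMap (Polynomial A) S (Polynomial.X ^ n))) fun i j hij => ?_
  by_contra hne
  have h1 : Polynomial.X ^ i - Polynomial.X ^ j ∈ P := by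
    rw [← IsLocalization.AtPrime.to_map_mem_maximal_iff S P, map_sub, ← residue_eq_zero_iff, map_sub]
    exact sub_eq_zero.2 hij
  have h2 := Ideal.mem_map_C_iff.1 h1 i
  rw [Polynomial.coeff_sub, Polynomial.coeff_X_pow_self, Polynomial.coeff_X_pow, if_neg hne] at h2
  simp at h2

/-! ### Modules with `𝔪E = xE` after extension, and their consequences over `A`. -/

section Ulrich

open scoped TensorProduct

/-- Multiplying `IF ⊆ xF + M` by `Iⁿ⁺¹` writes an element of `M ∩ Iⁿ⁺²F` as `xf + m'` with `f ∈
Iⁿ⁺¹F` and `m' ∈ Iⁿ⁺¹M`. As `x` is regular on `F/M`, also `f ∈ M`, and induction applies to `f`. -/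
theorem inf_pow_smul_top_le {R : Type*} [CommRing R] {I : Ideal R} {F : Type*} [AddCommGroup F]
    [Module R F] {M : Submodule R F} {x : R} (hxI : x ∈ I)
    (hx : ∀ f, x • f ∈ M → f ∈ M) (hI : I • ⊤ ≤ LinearMap.range (LinearMap.lsmul R F x) ⊔ M)
    (n : ℕ) : M ⊓ I ^ (n + 1) • ⊤ ≤ I ^ n • M := by
  induction n with
  | zero => simp
  | succ n ih =>
    rintro m ⟨hm, hm'⟩
    have h1 : (I ^ (n + 1 + 1) • ⊤ : Submodule R F) ≤
        (I ^ (n + 1) • ⊤ : Submodule R F).map (LinearMap.lsmul R F x) ⊔ I ^ (n + 1) • M := by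
      rw [pow_succ I (n + 1), mul_smul, Submodule.map_smul'', Submodule.map_top, ← Submodule.smul_sup]
      exact Submodule.smul_mono le_rfl hI
    obtain ⟨_, ⟨f, hf, rfl⟩, m', hm'', rfl⟩ := Submodule.mem_sup.1 (h1 hm')
    have hfM : f ∈ M := hx f (by
      have h2 := Submodule.sub_mem M hm (Submodule.smul_le_right hm'')
      simpa using h2)
    refine add_mem ?_ hm''
    rw [pow_succ', mul_smul]
    exact Submodule.smul_mem_smul hxI (ih ⟨hfM, hf⟩)

/-- Multiplication by `y` identifies `E/N` with `yE/yN`. -/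
theorem length_quotient_map_lsmul {R : Type*} [CommRing R] {E : Type*} [AddCommGroup E] [Module R E]
    {y : R} (hy : IsSMulRegular E y) (N : Submodule R E) :
    Module.length R (E ⧸ N.map (LinearMap.lsmul R E y)) =
      Module.length R (E ⧸ N) + Module.length R (E ⧸ LinearMap.range (LinearMap.lsmul R E y)) := by
  have hle : N.map (LinearMap.lsmul R E y) ≤ LinearMap.range (LinearMap.lsmul R E y) :=
    LinearMap.map_le_range
  let f : (E ⧸ N) →ₗ[R] E ⧸ N.map (LinearMap.lsmul R E y) :=
    Submodule.mapQ _ _ (LinearMap.lsmul R E y) (Submodule.le_comap_map _ _)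
  refine Module.length_eq_add_of_exact f (Submodule.factor hle) ?_
    (Submodule.factor_surjective hle) ?_
  · rw [injective_iff_map_eq_zero]
    intro z hz
    obtain ⟨u, rfl⟩ := Submodule.mkQ_surjective _ z
    obtain ⟨v, hv, hvu⟩ := (Submodule.Quotient.mk_eq_zero _).1 hz
    exact (Submodule.Quotient.mk_eq_zero _).2 ((hy hvu : v = u) ▸ hv)
  · intro z
    obtain ⟨u, rfl⟩ := Submodule.mkQ_surjective _ z
    constructor
    · intro hz
      obtain ⟨v, rfl⟩ := (Submodule.Quotient.mk_eq_zero _).1 hz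
      exact ⟨Submodule.mkQ _ v, rfl⟩
    · rintro ⟨v, hv⟩
      obtain ⟨v, rfl⟩ := Submodule.mkQ_surjective _ v
      rw [← hv]
      exact (Submodule.Quotient.mk_eq_zero _).2 ⟨v, rfl⟩

theorem hilbertSamuel_succ_le {A : Type*} [CommRing A] [IsLocalRing A] {E : Type*} [AddCommGroup E]
    [Module A E] {y : A} (hy : y ∈ maximalIdeal A) (hyE : IsSMulRegular E y) (n : ℕ) :
    hilbertSamuel A E (n + 1) ≤ hilbertSamuel A E n +
      Module.length A (E ⧸ LinearMap.range (LinearMap.lsmul A E y)) := by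
  rw [hilbertSamuel, hilbertSamuel, ← length_quotient_map_lsmul hyE]
  have hle : (maximalIdeal A ^ n • ⊤ : Submodule A E).map (LinearMap.lsmul A E y) ≤
      maximalIdeal A ^ (n + 1) • ⊤ := by
    rintro _ ⟨u, hu, rfl⟩
    rw [pow_succ', mul_smul]
    exact Submodule.smul_mem_smul hy hu
  exact Module.length_le_of_surjective _ (Submodule.factor_surjective hle)

/-- For large `n` the submodule `xE + 𝔪ⁿ⁺¹E` of `𝔪E` has the same finite colength in `E` as `𝔪E`, so
the two coincide; Nakayama removes the term `𝔪ⁿ⁺¹E`. -/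
theorem smul_top_le_range_of_hilbertSamuel {A : Type*} [CommRing A] [IsLocalRing A]
    [IsNoetherianRing A] {E : Type*} [AddCommGroup E] [Module A E] [Module.Finite A E]
    {x : A} (hx : x ∈ maximalIdeal A) {c : ℕ}
    (hc : ∀ n ≥ c, ∀ u : E, x • u ∈ (maximalIdeal A ^ (n + 1) • ⊤ : Submodule A E) →
      u ∈ (maximalIdeal A ^ n • ⊤ : Submodule A E))
    (hL : ∀ᶠ n in Filter.atTop, hilbertSamuel A E (n + 1) =
      hilbertSamuel A E n + hilbertSamuel A E 1) :
    (maximalIdeal A • ⊤ : Submodule A E) ≤ LinearMap.range (LinearMap.lsmul A E x) := by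
  obtain ⟨n₀, hn₀⟩ := Filter.eventually_atTop.1 hL
  obtain ⟨n, hn1, hn2, hn3⟩ : ∃ n, n₀ ≤ n ∧ c ≤ n ∧ 1 ≤ n := ⟨n₀ + c + 1, by omega⟩
  have h1 := hn₀ n hn1
  rw [hilbertSamuel_succ hx (hc n hn2)] at h1
  replace h1 := ENat.add_right_injective_of_ne_top (hilbertSamuel_ne_top n) h1
  set Q := LinearMap.range (LinearMap.lsmul A E x) ⊔ (maximalIdeal A ^ (n + 1) • ⊤)
  have hQ : Q ≤ maximalIdeal A ^ 1 • ⊤ := by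
    refine sup_le ?_ (Submodule.smul_mono_left (Ideal.pow_le_pow_right (by omega)))
    rintro _ ⟨u, rfl⟩
    rw [pow_one]
    exact Submodule.smul_mem_smul hx trivial
  have hQeq : (maximalIdeal A ^ 1 • ⊤ : Submodule A E) ≤ Q := by
    let g := Submodule.factor hQ
    have h2 := Module.length_eq_add_of_exact (LinearMap.ker g).subtype g (Submodule.subtype_injective _)
      (Submodule.factor_surjective hQ) (LinearMap.exact_subtype_ker_map g)
    rw [h1] at h2
    have h3 : Module.length A (LinearMap.ker g) = 0 := by
      have h4 : Module.length A (LinearMap.ker g) + hilbertSamuel A E 1 = 0 + hilbertSamuel A E 1 := by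
        rw [zero_add]; exact h2.symm
      exact ENat.add_left_injective_of_ne_top (hilbertSamuel_ne_top 1) h4
    have h5 : Subsingleton (LinearMap.ker g) := Module.length_eq_zero_iff.1 h3
    intro u hu
    have h6 : Submodule.mkQ Q u ∈ LinearMap.ker g := (Submodule.Quotient.mk_eq_zero _).2 hu
    have h7 : (⟨_, h6⟩ : LinearMap.ker g) = 0 := Subsingleton.elim _ _
    exact (Submodule.Quotient.mk_eq_zero _).1 (congrArg Subtype.val h7)
  rw [pow_one] at hQeq
  refine Submodule.le_of_le_smul_of_le_jacobson_bot (IsNoetherian.noetherian _)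
    (maximalIdeal_le_jacobson _) (hQeq.trans (sup_le_sup le_rfl ?_))
  rw [← mul_smul, ← pow_two]
  exact Submodule.smul_mono_left (Ideal.pow_le_pow_right (by omega))

variable {A : Type u} [CommRing A] [IsLocalRing A] [IsNoetherianRing A]
  {E : Type u} [AddCommGroup E] [Module A E] [Module.Finite A E]

/-- If the Hilbert function of a module of positive depth is eventually equal to the minimal number
of generators, then after a faithfully flat local extension with extended maximal ideal, `𝔪 E` is
generated by the multiples of a single regular element. -/
theorem exists_extension_smul_top_le_range {y : A} (hy : y ∈ maximalIdeal A)
    (hyE : IsSMulRegular E y)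
    (hL : ∀ᶠ n in Filter.atTop, hilbertSamuel A E (n + 1) =
      hilbertSamuel A E n + hilbertSamuel A E 1) :
    ∃ (S : Type u) (_ : CommRing S) (_ : IsLocalRing S) (_ : Algebra A S)
      (_ : Module.FaithfullyFlat A S), (maximalIdeal A).map (algebraMap A S) = maximalIdeal S ∧
      ∃ x ∈ maximalIdeal S, IsSMulRegular (S ⊗[A] E) x ∧
        (maximalIdeal S • ⊤ : Submodule S (S ⊗[A] E)) ≤
          LinearMap.range (LinearMap.lsmul S (S ⊗[A] E) x) := by
  obtain ⟨S, _, _, _, _, _, hS, _⟩ := exists_faithfullyFlat_infinite_residueField A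
  have hyS : algebraMap A S y ∈ maximalIdeal S := hS ▸ Ideal.mem_map_of_mem _ hy
  obtain ⟨x, hx, hreg, c, hc⟩ := exists_isSMulRegular_superficial (A := S) (E := S ⊗[A] E) hyS
    (isSMulRegular_tensorProduct hyE)
  refine ⟨S, _, _, _, ‹_›, hS, x, hx, hreg, smul_top_le_range_of_hilbertSamuel hx hc ?_⟩
  simpa only [hilbertSamuel_tensorProduct hS] using hL

theorem pow_succ_smul_top_le_map {R : Type*} [CommRing R] {I : Ideal R} {F : Type*}
    [AddCommGroup F] [Module R F] {x : R}
    (h : (I • ⊤ : Submodule R F) ≤ LinearMap.range (LinearMap.lsmul R F x)) (n : ℕ) :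
    (I ^ (n + 1) • ⊤ : Submodule R F) ≤
      (I ^ n • ⊤ : Submodule R F).map (LinearMap.lsmul R F x) := by
  rw [pow_succ, mul_smul, Submodule.map_smul'', Submodule.map_top]
  exact Submodule.smul_mono le_rfl h

/-- This is the positive depth of `G(E)`. It is phrased with all of `𝔪` because the good element `x`
exists only over `S`; since `𝔪` generates the maximal ideal of `S`, the hypothesis extends to `x`,
and `𝔪ⁿ⁺¹E = x𝔪ⁿE` allows cancellation. -/
theorem mem_pow_smul_top_of_forall_smul_mem {y : A} (hy : y ∈ maximalIdeal A)
    (hyE : IsSMulRegular E y)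
    (hL : ∀ᶠ n in Filter.atTop, hilbertSamuel A E (n + 1) =
      hilbertSamuel A E n + hilbertSamuel A E 1) {n : ℕ} {u : E}
    (hu : ∀ a ∈ maximalIdeal A, a • u ∈ (maximalIdeal A ^ (n + 1) • ⊤ : Submodule A E)) :
    u ∈ (maximalIdeal A ^ n • ⊤ : Submodule A E) := by
  obtain ⟨S, _, _, _, _, hS, x, hx, hreg, hle⟩ := exists_extension_smul_top_le_range hy hyE hL
  rw [← one_tmul_mem_baseChange (S := S), baseChange_pow_smul_top, hS]
  have h1 : maximalIdeal S ≤ ((maximalIdeal S ^ (n + 1) • ⊤ : Submodule S (S ⊗[A] E)).comap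
      (LinearMap.toSpanSingleton S _ ((1 : S) ⊗ₜ[A] u))) := by
    conv_lhs => rw [← hS]
    refine Ideal.map_le_iff_le_comap.2 fun a ha => ?_
    change algebraMap A S a • ((1 : S) ⊗ₜ[A] u) ∈
      (maximalIdeal S ^ (n + 1) • ⊤ : Submodule S (S ⊗[A] E))
    rw [algebraMap_smul, ← TensorProduct.tmul_smul, ← hS, ← baseChange_pow_smul_top]
    exact Submodule.tmul_mem_baseChange_of_mem _ (hu a ha)
  obtain ⟨w, hw, hwu⟩ := pow_succ_smul_top_le_map hle n (h1 hx)
  have : w = (1 : S) ⊗ₜ[A] u := hreg hwu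
  exact this ▸ hw

/-- Over `S`, multiplication by the regular element `x` maps `E` isomorphically onto `𝔪E`, hence
`E/𝔪E` onto `𝔪E/𝔪²E`. -/
theorem hilbertSamuel_two {y : A} (hy : y ∈ maximalIdeal A) (hyE : IsSMulRegular E y)
    (hL : ∀ᶠ n in Filter.atTop, hilbertSamuel A E (n + 1) =
      hilbertSamuel A E n + hilbertSamuel A E 1) :
    hilbertSamuel A E 2 = hilbertSamuel A E 1 + hilbertSamuel A E 1 := by
  obtain ⟨S, _, _, _, _, hS, x, hx, hreg, hle⟩ := exists_extension_smul_top_le_range hy hyE hL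
  have h := hilbertSamuel_succ (A := S) (E := S ⊗[A] E) hx (n := 1) fun u hu => by
    obtain ⟨w, hw, hwu⟩ := pow_succ_smul_top_le_map hle 1 hu
    exact (hreg hwu : w = u) ▸ hw
  have h2 : LinearMap.range (LinearMap.lsmul S (S ⊗[A] E) x) ⊔
      (maximalIdeal S ^ (1 + 1) • ⊤ : Submodule S (S ⊗[A] E)) = maximalIdeal S ^ 1 • ⊤ := by
    apply le_antisymm
    · refine sup_le ?_ (Submodule.smul_mono_left (Ideal.pow_le_pow_right (by omega)))
      rintro _ ⟨u, rfl⟩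
      rw [pow_one]
      exact Submodule.smul_mem_smul hx trivial
    · rw [pow_one]
      exact hle.trans le_sup_left
  rw [h2] at h
  change _ = _ + hilbertSamuel S (S ⊗[A] E) 1 at h
  simpa only [hilbertSamuel_tensorProduct hS] using h

theorem ker_inf_pow_smul_top_le {y : A} (hy : y ∈ maximalIdeal A) (hyE : IsSMulRegular E y)
    (hL : ∀ᶠ n in Filter.atTop, hilbertSamuel A E (n + 1) =
      hilbertSamuel A E n + hilbertSamuel A E 1) {F : Type*} [AddCommGroup F] [Module A F]
    (ε : F →ₗ[A] E) (hε : Function.Surjective ε) (n : ℕ) : LinearMap.ker ε ⊓ maximalIdeal A ^ (n + 1) • ⊤ ≤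
      maximalIdeal A ^ n • LinearMap.ker ε := by
  obtain ⟨S, _, _, _, _, hS, x, hx, hreg, hle⟩ := exists_extension_smul_top_le_range hy hyE hL
  have hkerS := ker_baseChange_of_surjective (S := S) ε hε
  have hεS : Function.Surjective (ε.baseChange S) := LinearMap.baseChange_surjective S hε
  rintro m ⟨hm, hpow⟩
  rw [← one_tmul_mem_baseChange (S := S), baseChange_smul_eq, Ideal.map_pow, hS]
  refine inf_pow_smul_top_le (M := (LinearMap.ker ε).baseChange S) hx ?_ ?_ n
    ⟨Submodule.tmul_mem_baseChange_of_mem _ hm, ?_⟩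
  · intro f hf
    rw [← hkerS, LinearMap.mem_ker] at hf ⊢
    rw [map_smul] at hf
    exact hreg.right_eq_zero_of_smul hf
  · intro f hf
    have h1 : ε.baseChange S f ∈ (maximalIdeal S • ⊤ : Submodule S (S ⊗[A] E)) :=
      Submodule.smul_top_le_comap_smul_top _ (ε.baseChange S) hf
    obtain ⟨e, he⟩ := hle h1
    obtain ⟨g, rfl⟩ := hεS e
    refine Submodule.mem_sup.2 ⟨x • g, ⟨g, rfl⟩, f - x • g, ?_, by abel⟩
    rw [← hkerS, LinearMap.mem_ker, map_sub, map_smul, sub_eq_zero]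
    exact he.symm
  · rw [← hS, ← baseChange_pow_smul_top]
    exact Submodule.tmul_mem_baseChange_of_mem _ hpow

/-- The Hilbert function of a module with a regular element `y ∈ 𝔪` such that `E / y E` has finite
length is eventually constant. -/
theorem exists_eventually_hilbertSamuel_succ {y : A} (hy : y ∈ maximalIdeal A)
    (hyE : IsSMulRegular E y)
    (hfin : Module.length A (E ⧸ LinearMap.range (LinearMap.lsmul A E y)) ≠ ⊤) :
    ∃ e : ℕ∞, ∀ᶠ n in Filter.atTop, hilbertSamuel A E (n + 1) = hilbertSamuel A E n + e := by
  obtain ⟨S, _, _, _, _, _, hS, _⟩ := exists_faithfullyFlat_infinite_residueField A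
  have hyS : algebraMap A S y ∈ maximalIdeal S := hS ▸ Ideal.mem_map_of_mem _ hy
  obtain ⟨x, hx, -, c, hc⟩ := exists_isSMulRegular_superficial (A := S) (E := S ⊗[A] E) hyS
    (isSMulRegular_tensorProduct hyE)
  -- For large `n` this is the first difference of the Hilbert–Samuel function. It is nondecreasing,
  -- and bounded by `ℓ(E/yE)`, so it stabilizes.
  let D : ℕ → ℕ∞ := fun n => Module.length S ((S ⊗[A] E) ⧸
    (LinearMap.range (LinearMap.lsmul S (S ⊗[A] E) x) ⊔ (maximalIdeal S ^ (n + 1) • ⊤)))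
  have hD : ∀ n ≥ c, hilbertSamuel A E (n + 1) = hilbertSamuel A E n + D n := fun n hn => by
    have := hilbertSamuel_succ hx (hc n hn)
    simpa only [hilbertSamuel_tensorProduct hS] using this
  have hmono : Monotone D := fun m n hmn => by
    refine Module.length_le_of_surjective (Submodule.factor (sup_le_sup le_rfl
      (Submodule.smul_mono_left (Ideal.pow_le_pow_right (by omega))))) (Submodule.factor_surjective _)
  have hbd : ∀ n ≥ c, D n ≤ Module.length A (E ⧸ LinearMap.range (LinearMap.lsmul A E y)) :=
    fun n hn => by
      have h1 := hilbertSamuel_succ_le hy hyE n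
      rw [hD n hn] at h1
      exact (ENat.add_le_add_iff_left (hilbertSamuel_ne_top n)).1 h1
  obtain ⟨C, hC⟩ := ENat.ne_top_iff_exists.1 hfin
  have hDt : ∀ n ≥ c, D n ≠ ⊤ := fun n hn => ne_top_of_le_ne_top hfin (hbd n hn)
  -- Minimizing `C - D` maximizes `D`: the truncated subtraction is exact because `D ≤ C` in this
  -- range.
  obtain ⟨n₀, hn₀⟩ : ∃ n₀, ∀ n, C - (D (c + n₀)).toNat ≤ C - (D (c + n)).toNat :=
    ⟨_, fun n => Function.argmin_le (fun n => C - (D (c + n)).toNat) n⟩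
  refine ⟨D (c + n₀), Filter.eventually_atTop.2 ⟨c + n₀, fun n hn => ?_⟩⟩
  rw [hD n (by omega)]
  congr 1
  obtain ⟨k, rfl⟩ := Nat.exists_eq_add_of_le (show c ≤ n by omega)
  have h1 := hn₀ k
  have h2 := hmono hn
  have h3 := hbd (c + k) (by omega)
  have h4 := hbd (c + n₀) (by omega)
  obtain ⟨p, hp⟩ := ENat.ne_top_iff_exists.1 (hDt (c + k) (by omega))
  obtain ⟨q, hq⟩ := ENat.ne_top_iff_exists.1 (hDt (c + n₀) (by omega))
  rw [← hp, ← hq] at h1 h2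
  rw [← hC, ← hp] at h3
  rw [← hC, ← hq] at h4
  rw [← hp, ← hq]
  simp only [ENat.toNat_natCast, Nat.cast_le] at h1 h2 h3 h4
  congr 1
  omega

end Ulrich

/-! ### Quadratic growth of `ℓ(A/𝔪ⁿ)` and comparison with `G(A)`. -/

section Growth

theorem length_quotient_range_lsmul_pow {R : Type*} [CommRing R] {E : Type*} [AddCommGroup E]
    [Module R E] {y : R} (hy : IsSMulRegular E y) (n : ℕ) :
    Module.length R (E ⧸ LinearMap.range (LinearMap.lsmul R E (y ^ n))) =
      n * Module.length R (E ⧸ LinearMap.range (LinearMap.lsmul R E y)) := by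
  induction n with
  | zero =>
    have : LinearMap.range (LinearMap.lsmul R E (y ^ 0)) = ⊤ :=
      LinearMap.range_eq_top.2 fun u => ⟨u, by simp⟩
    rw [this]
    simp [Module.length_eq_zero]
  | succ n ih =>
    have : LinearMap.range (LinearMap.lsmul R E (y ^ (n + 1))) =
        (LinearMap.range (LinearMap.lsmul R E (y ^ n))).map (LinearMap.lsmul R E y) := by
      rw [← LinearMap.range_comp]
      congr 1
      ext u
      simp only [LinearMap.lsmul_apply, LinearMap.comp_apply, pow_succ', mul_smul]
    rw [this, length_quotient_map_lsmul hy, ih]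
    push_cast
    ring

theorem length_quotient_sup_span_pow {R : Type*} [CommRing R] {I : Ideal R} {y : R}
    (hy : IsSMulRegular (R ⧸ I) y) (n : ℕ) :
    Module.length R (R ⧸ (I ⊔ Ideal.span {y ^ n})) =
      n * Module.length R (R ⧸ (I ⊔ Ideal.span {y})) := by
  have key : ∀ z : R, Module.length R (R ⧸ (I ⊔ Ideal.span {z})) =
      Module.length R ((R ⧸ I) ⧸ LinearMap.range (LinearMap.lsmul R (R ⧸ I) z)) := fun z => by
    rw [← (Submodule.quotientQuotientEquivQuotientSup I (Ideal.span {z})).length_eq]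
    have : Submodule.map (Submodule.mkQ I) (Ideal.span {z}) =
        LinearMap.range (LinearMap.lsmul R (R ⧸ I) z) := by
      ext w
      constructor
      · rintro ⟨v, hv, rfl⟩
        obtain ⟨t, rfl⟩ := Ideal.mem_span_singleton'.1 hv
        exact ⟨Submodule.mkQ I t, by rw [LinearMap.lsmul_apply, ← map_smul, smul_eq_mul, mul_comm]⟩
      · rintro ⟨t, rfl⟩
        obtain ⟨t, rfl⟩ := Submodule.mkQ_surjective _ t
        refine ⟨t * z, Ideal.mem_span_singleton'.2 ⟨t, rfl⟩, ?_⟩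
        rw [LinearMap.lsmul_apply, ← map_smul, smul_eq_mul, mul_comm]
    exact (Submodule.quotEquivOfEq _ _ this).length_eq
  rw [key, key, length_quotient_range_lsmul_pow hy]

theorem isWeaklyRegular_pair_iff {R : Type*} [CommRing R] {x y : R} :
    IsWeaklyRegular R [x, y] ↔ IsSMulRegular R x ∧ IsSMulRegular (R ⧸ Ideal.span {x}) y := by
  rw [isWeaklyRegular_cons_iff, isWeaklyRegular_singleton_iff]
  refine and_congr_right' (LinearEquiv.isSMulRegular_congr (Submodule.quotEquivOfEq _ _ ?_) y)
  rw [← Submodule.ideal_span_singleton_smul, smul_eq_mul, Ideal.mul_top]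

section LocalRing

variable {A : Type*} [CommRing A] [IsLocalRing A] [IsNoetherianRing A]

theorem length_quotient_span_pow_sup_span_pow {x y : A} (hx : x ∈ maximalIdeal A)
    (hy : y ∈ maximalIdeal A) (h : IsWeaklyRegular A [x, y]) {n : ℕ} (hn : n ≠ 0) :
    Module.length A (A ⧸ (Ideal.span {x ^ n} ⊔ Ideal.span {y ^ n})) =
      n ^ 2 * Module.length A (A ⧸ (Ideal.span {x} ⊔ Ideal.span {y})) := by
  -- Permutability of regular sequences in a local ring lets each exponent be raised while its
  -- element is the last one.
  have hswap : ∀ {x y : A}, x ∈ maximalIdeal A → y ∈ maximalIdeal A →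
      IsWeaklyRegular A [x, y] → IsWeaklyRegular A [y, x] := fun hx hy h =>
    IsLocalRing.isWeaklyRegular_of_perm_of_subset_maximalIdeal h (List.Perm.swap _ _ _) (by
      rintro r hr
      rcases List.mem_pair.1 hr with rfl | rfl <;> assumption)
  have h1 := isWeaklyRegular_pair_iff.1 (hswap hx hy h)
  have h2 : IsWeaklyRegular A [x ^ n, y] :=
    hswap hy (Ideal.pow_mem_of_mem _ hx n (Nat.pos_of_ne_zero hn))
      (isWeaklyRegular_pair_iff.2 ⟨h1.1, h1.2.pow n⟩)
  rw [length_quotient_sup_span_pow (isWeaklyRegular_pair_iff.1 h2).2, sup_comm,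
    length_quotient_sup_span_pow h1.2, sup_comm, ← mul_assoc, pow_two]

theorem hilbertSamuel_self (A : Type*) [CommRing A] [IsLocalRing A] (n : ℕ) :
    hilbertSamuel A A n = Module.length A (A ⧸ maximalIdeal A ^ n) :=
  (Submodule.quotEquivOfEq _ _ (by rw [smul_eq_mul, Ideal.mul_top])).length_eq

/-- The Hilbert-Samuel function of a two-dimensional Cohen-Macaulay local ring grows
quadratically. -/
theorem exists_hilbertSamuel_bounds (hdim : ringKrullDim A = 2)
    (hdepth : 2 ≤ depth (maximalIdeal A) A) :
    ∃ C N : ℕ, ∀ n ≠ 0, hilbertSamuel A A n ≤ (n ^ 2 * C : ℕ) ∧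
      (n ^ 2 : ℕ) ≤ hilbertSamuel A A (N * n) := by
  obtain ⟨rs, hrs, hmem, hlen⟩ := exists_isWeaklyRegular_of_le_depth (n := 2) hdepth
  obtain ⟨x, y, rfl⟩ := List.length_eq_two.1 hlen
  have hx := hmem x (by simp)
  have hy := hmem y (by simp)
  have hreg : IsRegular A [x, y] :=
    (IsLocalRing.isRegular_iff_isWeaklyRegular_of_subset_maximalIdeal hmem).2 hrs
  set q : Ideal A := Ideal.span {x} ⊔ Ideal.span {y}
  have hq : Ideal.ofList [x, y] = q := by simp [q]
  have hqle : q ≤ maximalIdeal A := sup_le ((Ideal.span_singleton_le_iff_mem _).2 hx)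
    ((Ideal.span_singleton_le_iff_mem _).2 hy)
  have hqne : q ≠ ⊤ := ne_top_of_le_ne_top (maximalIdeal.isMaximal A).ne_top hqle
  have : Nontrivial (A ⧸ q) := Ideal.Quotient.nontrivial_iff.2 hqne
  have : IsLocalRing (A ⧸ q) := .of_surjective' (Ideal.Quotient.mk _) Ideal.Quotient.mk_surjective
  have hdim0 : ringKrullDim (A ⧸ q) = 0 := by
    have h := ringKrullDim_add_length_eq_ringKrullDim_of_isRegular [x, y] hreg
    rw [hdim, hq] at h
    have h2 : ringKrullDim (A ⧸ q) + (2 : ℕ) = 0 + (2 : ℕ) := by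
      rw [zero_add]; exact h
    exact ENat.WithBot.add_natCast_cancel.1 h2
  have : IsArtinianRing (A ⧸ q) := by
    rw [isArtinianRing_iff_krullDimLE_zero, Ring.krullDimLE_iff, hdim0]
    rfl
  have hfin : Module.length A (A ⧸ q) ≠ ⊤ := by
    rw [Module.length_eq_of_surjective (R := A ⧸ q) Ideal.Quotient.mk_surjective]
    exact Module.length_ne_top
  obtain ⟨C, hC⟩ := ENat.ne_top_iff_exists.1 hfin
  have hpos : 1 ≤ Module.length A (A ⧸ q) := Order.one_le_iff_pos.2 Module.length_pos
  obtain ⟨N, hN⟩ := (isArtinianRing_iff_isNilpotent_maximalIdeal (A ⧸ q)).1 inferInstance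
  have hNq : maximalIdeal A ^ N ≤ q := by
    rw [← map_maximalIdeal_of_surjective (Ideal.Quotient.mk q)
      Ideal.Quotient.mk_surjective, ← Ideal.map_pow, Ideal.zero_eq_bot, Ideal.map_eq_bot_iff_le_ker,
      Ideal.mk_ker] at hN
    exact hN
  -- The bounds come from `(xⁿ, yⁿ) ⊆ 𝔪ⁿ` and from `𝔪^(2Nn) ⊆ q^(2n) ⊆ (xⁿ, yⁿ)`, where `𝔪^N ⊆ q`.
  refine ⟨C, 2 * N, fun n hn => ⟨?_, ?_⟩⟩
  · have hle : Ideal.span {x ^ n} ⊔ Ideal.span {y ^ n} ≤ maximalIdeal A ^ n :=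
      sup_le ((Ideal.span_singleton_le_iff_mem _).2 (Ideal.pow_mem_pow hx n))
        ((Ideal.span_singleton_le_iff_mem _).2 (Ideal.pow_mem_pow hy n))
    rw [hilbertSamuel_self A]
    refine (Module.length_le_of_surjective _ (Submodule.factor_surjective hle)).trans ?_
    rw [length_quotient_span_pow_sup_span_pow hx hy hrs hn, ← hC]
    push_cast
    rfl
  · have hle : maximalIdeal A ^ (2 * N * n) ≤ Ideal.span {x ^ n} ⊔ Ideal.span {y ^ n} := by
      rw [show 2 * N * n = N * (n + n) by ring, pow_mul, ← Ideal.span_singleton_pow,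
        ← Ideal.span_singleton_pow]
      exact (Ideal.pow_right_mono hNq _).trans Ideal.sup_pow_add_le_pow_sup_pow
    rw [hilbertSamuel_self A]
    refine le_trans ?_ (Module.length_le_of_surjective _ (Submodule.factor_surjective hle))
    rw [length_quotient_span_pow_sup_span_pow hx hy hrs hn]
    push_cast
    exact le_mul_of_one_le_right' hpos

end LocalRing

variable {A : Type u} [CommRing A] [IsLocalRing A]

/-- The ideal of initial forms of the elements of an ideal. -/
def initialIdeal (J : Ideal A) : Ideal (AssocGradedRing A) :=
  Ideal.map AssocGradedRing.mk
    { carrier := {r : Rees A | ∀ i, r.coeff i ∈ J ⊓ maximalIdeal A ^ i ⊔ maximalIdeal A ^ (i + 1)}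
      add_mem' := fun ha hb i => by
        rw [Rees.coeff_add]; exact add_mem (ha i) (hb i)
      zero_mem' := fun i => by simp
      smul_mem' := fun c r hr i => by
        rw [smul_eq_mul, Rees.coeff_mul]
        refine sum_mem fun z hz => ?_
        rw [← Finset.HasAntidiagonal.mem_antidiagonal.1 hz]
        obtain ⟨j, hj, k, hk, hjk⟩ := Submodule.mem_sup.1 (hr z.2)
        rw [← hjk, mul_add]
        refine add_mem (Submodule.mem_sup_left ⟨J.mul_mem_left _ hj.1, ?_⟩)
          (Submodule.mem_sup_right ?_)
        · rw [pow_add]; exact Ideal.mul_mem_mul (Rees.coeff_mem _ _) hj.2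
        · rw [add_assoc, pow_add]; exact Ideal.mul_mem_mul (Rees.coeff_mem _ _) hk }

theorem mk_mem_initialIdeal {J : Ideal A} {r : Rees A} :
    AssocGradedRing.mk r ∈ initialIdeal J ↔
      ∀ i, r.coeff i ∈ J ⊓ maximalIdeal A ^ i ⊔ maximalIdeal A ^ (i + 1) := by
  constructor
  · intro h i
    obtain ⟨s, hs, hsr⟩ :=
      (Ideal.mem_map_iff_of_surjective _ AssocGradedRing.mk_surjective).1 h
    have h0 : AssocGradedRing.mk (r - s) = 0 := by rw [map_sub, hsr, sub_self]
    have h1 := AssocGradedRing.mk_eq_zero.1 h0 i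
    rw [Rees.coeff_sub] at h1
    rw [← sub_add_cancel (r.coeff i) (s.coeff i)]
    exact add_mem (Submodule.mem_sup_right h1) (hs i)
  · exact fun h => Ideal.mem_map_of_mem _ h

theorem initialIdeal_mono {J J' : Ideal A} (h : J ≤ J') : initialIdeal J ≤ initialIdeal J' := by
  intro z hz
  obtain ⟨r, rfl⟩ := AssocGradedRing.mk_surjective z
  rw [mk_mem_initialIdeal] at hz ⊢
  exact fun i => sup_le_sup (inf_le_inf h le_rfl) le_rfl (hz i)

/-- An element of `J'` can be changed by an element of `J` so as to cancel its initial form.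
Repeating this pushes it into `𝔪ⁿ ⊆ J`. -/
theorem le_of_initialIdeal_le {n : ℕ} {J J' : Ideal A} (hJ : maximalIdeal A ^ n ≤ J)
    (hJJ : J ≤ J') (h : initialIdeal J' ≤ initialIdeal J) : J' ≤ J := by
  have key : ∀ k ≤ n, J' ⊓ maximalIdeal A ^ (n - k) ≤ J := by
    intro k
    induction k with
    | zero => exact fun _ => inf_le_right.trans hJ
    | succ k ih =>
      rintro hk u ⟨hu, hu'⟩
      have h1 : AssocGradedRing.mk (Rees.monomial (n - (k + 1)) u hu') ∈ initialIdeal J' := by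
        rw [mk_mem_initialIdeal]
        intro i
        rw [Rees.coeff_monomial]
        split_ifs with hi
        · subst hi; exact Submodule.mem_sup_left ⟨hu, hu'⟩
        · exact zero_mem _
      have h2 := mk_mem_initialIdeal.1 (h h1) (n - (k + 1))
      rw [Rees.coeff_monomial, if_pos rfl] at h2
      obtain ⟨j, hj, v, hv, rfl⟩ := Submodule.mem_sup.1 h2
      have hv' : v ∈ J' := by simpa using J'.sub_mem hu (hJJ hj.1)
      refine add_mem hj.1 (ih (by omega) ⟨hv', ?_⟩)
      rwa [show n - (k + 1) + 1 = n - k by omega] at hv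
  simpa using key n le_rfl

theorem irrelevant_pow_le_initialIdeal {n : ℕ} {J : Ideal A} (hJ : maximalIdeal A ^ n ≤ J) :
    irrelevant A ^ n ≤ initialIdeal J := by
  have h1 : irrelevant A ^ n = (reesPositive A ^ n).map AssocGradedRing.mk :=
    (Ideal.map_pow _ _ _).symm
  rw [h1, Ideal.map_le_iff_le_comap]
  intro r hr
  rw [Ideal.mem_comap, mk_mem_initialIdeal]
  intro i
  let φ : Rees A →+* Polynomial A := (reesAlgebra (maximalIdeal A)).toSubring.subtype
  have h2 : reesPositive A ^ n ≤ (Ideal.span {Polynomial.X ^ n}).comap φ := by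
    rw [← Ideal.span_singleton_pow, ← Ideal.map_le_iff_le_comap, Ideal.map_pow]
    refine Ideal.pow_right_mono (Ideal.map_le_iff_le_comap.2 fun s hs => ?_) n
    rw [Ideal.mem_comap, Ideal.mem_span_singleton, Polynomial.X_dvd_iff]
    exact hs
  have h3 := Polynomial.X_pow_dvd_iff.1 (Ideal.mem_span_singleton.1 (h2 hr)) i
  by_cases hi : i < n
  · have : r.coeff i = 0 := h3 hi
    rw [this]
    exact zero_mem _
  · exact Submodule.mem_sup_left
      ⟨hJ (Ideal.pow_le_pow_right (not_lt.1 hi) (r.coeff_mem i)), r.coeff_mem i⟩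

/-- Both lengths are Krull dimensions of posets of ideals, those above `𝔪ⁿ` and those above the
`n`-th power of the irrelevant ideal; taking initial ideals is strictly monotone from the first to
the second. -/
theorem hilbertSamuel_le_length_quotient_irrelevant_pow [IsNoetherianRing A] (n : ℕ) :
    hilbertSamuel A A n ≤
      Module.length (AssocGradedRing A) (AssocGradedRing A ⧸ irrelevant A ^ n) := by
  rw [hilbertSamuel_self A, Module.length_quotient, Module.length_quotient,
    ← WithBot.coe_le_coe, Order.coheight_eq_krullDim_Ici, Order.coheight_eq_krullDim_Ici]
  refine Order.krullDim_le_of_strictMono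
    (fun J : Set.Ici (maximalIdeal A ^ n) =>
      (⟨initialIdeal J.1, irrelevant_pow_le_initialIdeal J.2⟩ : Set.Ici (irrelevant A ^ n))) ?_
  intro J J' hlt
  refine lt_of_le_not_ge (initialIdeal_mono hlt.le) fun h => ?_
  exact hlt.not_ge (le_of_initialIdeal_le J.2 hlt.le h)

end Growth

/-! ### The dimension of `G(A)`. -/

section Dimension

/-- Modulo `I + (f)` only the constant term survives, so it vanishes; then one factor `f` is
cancelled modulo `I`. Taking `V` to be an arbitrary set lets the lemma be iterated along a regular
sequence. -/
theorem eq_zero_of_sum_pow_mul_mem {R : Type*} [CommRing R] {I : Ideal R} {f : R}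
    (hf : ∀ u, f * u ∈ I → u ∈ I) (V : Set R) (hV : ∀ v ∈ V, v ∈ I ⊔ Ideal.span {f} → v = 0)
    {n : ℕ} {v : ℕ → R} (hv : ∀ i < n, v i ∈ V)
    (h : ∑ i ∈ Finset.range n, f ^ i * v i ∈ I) : ∀ i < n, v i = 0 := by
  induction n generalizing v with
  | zero => simp
  | succ n ih =>
    rw [Finset.sum_range_succ'] at h
    have hsum : ∑ i ∈ Finset.range n, f ^ (i + 1) * v (i + 1) =
        f * ∑ i ∈ Finset.range n, f ^ i * v (i + 1) := by
      rw [Finset.mul_sum]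
      exact Finset.sum_congr rfl fun i _ => by ring
    rw [hsum, pow_zero, one_mul] at h
    have h0 : v 0 = 0 := by
      refine hV _ (hv 0 (by omega)) ?_
      have h1 := (I ⊔ Ideal.span {f}).sub_mem (Submodule.mem_sup_left h)
        (Submodule.mem_sup_right (Ideal.mul_mem_right
          (∑ i ∈ Finset.range n, f ^ i * v (i + 1)) _ (Ideal.mem_span_singleton_self f)))
      simpa using h1
    rw [h0, add_zero] at h
    intro i hi
    rcases i with _ | i
    · exact h0
    · exact ih (v := fun i => v (i + 1)) (fun i hi => hv _ (by omega)) (hf _ h) i (by omega)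

variable {A : Type u} [CommRing A] [IsLocalRing A]

theorem hilbertSamuel_self_succ (n : ℕ) :
    hilbertSamuel A A (n + 1) = Module.length A ((maximalIdeal A ^ n : Ideal A) ⧸
      (maximalIdeal A ^ (n + 1)).submoduleOf (maximalIdeal A ^ n)) + hilbertSamuel A A n := by
  rw [hilbertSamuel_self, hilbertSamuel_self]
  have hle : maximalIdeal A ^ (n + 1) ≤ maximalIdeal A ^ n := Ideal.pow_le_pow_right (by omega)
  let f : ((maximalIdeal A ^ n : Ideal A) ⧸
      (maximalIdeal A ^ (n + 1)).submoduleOf (maximalIdeal A ^ n)) →ₗ[A]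
      A ⧸ maximalIdeal A ^ (n + 1) :=
    Submodule.mapQ _ _ (Submodule.subtype _) le_rfl
  refine Module.length_eq_add_of_exact f (Submodule.factor hle) ?_
    (Submodule.factor_surjective hle) ?_
  · rw [injective_iff_map_eq_zero]
    intro z hz
    obtain ⟨u, rfl⟩ := Submodule.mkQ_surjective _ z
    have hz' : (u : A) ∈ maximalIdeal A ^ (n + 1) := (Submodule.Quotient.mk_eq_zero _).1 hz
    exact (Submodule.Quotient.mk_eq_zero _).2 hz'
  · intro z
    obtain ⟨u, rfl⟩ := Submodule.mkQ_surjective _ z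
    constructor
    · intro hz
      have hz' : u ∈ maximalIdeal A ^ n := (Submodule.Quotient.mk_eq_zero _).1 hz
      exact ⟨Submodule.mkQ _ ⟨u, hz'⟩, rfl⟩
    · rintro ⟨v, hv⟩
      obtain ⟨v, rfl⟩ := Submodule.mkQ_surjective _ v
      rw [← hv]
      exact (Submodule.Quotient.mk_eq_zero _).2 v.2

theorem hilbertSamuel_eq_sum (n : ℕ) :
    hilbertSamuel A A n = ∑ j : Fin n, Module.length A ((maximalIdeal A ^ (j : ℕ) : Ideal A) ⧸
      (maximalIdeal A ^ ((j : ℕ) + 1)).submoduleOf (maximalIdeal A ^ (j : ℕ))) := by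
  induction n with
  | zero =>
    rw [hilbertSamuel_self, pow_zero]
    simp [Ideal.one_eq_top, Submodule.Quotient.subsingleton_iff]
  | succ n ih =>
    rw [hilbertSamuel_self_succ, ih, Fin.sum_univ_castSucc, add_comm]
    rfl

/-- A bound for the number of elements of the associated graded ring that are linearly independent
over the residue field and of bounded degree. -/
theorem card_le_hilbertSamuel {ι : Type*} [Fintype ι] {T : ℕ} (r : ι → Rees A)
    (hdeg : ∀ i, ∀ n, T ≤ n → (r i).coeff n = 0)
    (hind : ∀ w : ι → A, AssocGradedRing.mk (∑ i, algebraMap A (Rees A) (w i) * r i) = 0 →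
      ∀ i, w i ∈ maximalIdeal A) :
    (Fintype.card ι : ℕ∞) ≤ hilbertSamuel A A T := by
  let Q : Fin T → Type u := fun j => (maximalIdeal A ^ (j : ℕ) : Ideal A) ⧸
      (maximalIdeal A ^ ((j : ℕ) + 1)).submoduleOf (maximalIdeal A ^ (j : ℕ))
  -- `Ψ` reads off the combination in `G(A)` in degrees below `T`. Independence says that its kernel
  -- vanishes modulo `𝔪`, so `(A/𝔪)^ι` is a quotient of the image of `Ψ`.
  let Ψ : (ι → A) →ₗ[A] (∀ j, Q j) := LinearMap.pi fun j =>
    (Submodule.mkQ _) ∘ₗ Fintype.linearCombination A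
      (fun i => (⟨(r i).coeff j, (r i).coeff_mem j⟩ : (maximalIdeal A ^ (j : ℕ) : Ideal A)))
  let Θ : (ι → A) →ₗ[A] (ι → A ⧸ maximalIdeal A) :=
    LinearMap.pi fun i => (Submodule.mkQ (maximalIdeal A)) ∘ₗ LinearMap.proj i
  have hΘ : Function.Surjective Θ := fun z => by
    choose w hw using fun i => Submodule.mkQ_surjective (maximalIdeal A) (z i)
    exact ⟨w, funext hw⟩
  have hker : LinearMap.ker Ψ ≤ LinearMap.ker Θ := by
    intro w hw
    rw [LinearMap.mem_ker] at hw ⊢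
    funext i
    refine (Submodule.Quotient.mk_eq_zero _).2 (hind w ?_ i)
    rw [AssocGradedRing.mk_eq_zero]
    intro n
    rw [Rees.coeff_sum]
    simp only [Rees.coeff_algebraMap_mul]
    by_cases hn : n < T
    · have h1 := (Submodule.Quotient.mk_eq_zero _).1 (congrFun hw ⟨n, hn⟩)
      have h2 : ((Fintype.linearCombination A (fun i => (⟨(r i).coeff n, (r i).coeff_mem n⟩ :
        (maximalIdeal A ^ n : Ideal A))) w : (maximalIdeal A ^ n : Ideal A)) : A) ∈
        maximalIdeal A ^ (n + 1) := h1
      rw [Fintype.linearCombination_apply] at h2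
      simpa using h2
    · rw [Finset.sum_eq_zero fun i _ => by rw [hdeg i n (not_lt.1 hn), mul_zero]]
      exact zero_mem _
  have hsimple : Module.length A (A ⧸ maximalIdeal A) = 1 := by
    rw [Module.length_eq_one_iff]
    exact isSimpleModule_iff_quot_maximal.2 ⟨_, inferInstance, ⟨.refl _ _⟩⟩
  calc (Fintype.card ι : ℕ∞) = Module.length A (ι → A ⧸ maximalIdeal A) := by
        simp [hsimple]
    _ ≤ Module.length A ((ι → A) ⧸ LinearMap.ker Ψ) :=
        Module.length_le_of_surjective ((LinearMap.ker Ψ).liftQ Θ hker) (fun z => by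
          obtain ⟨w, rfl⟩ := hΘ z
          exact ⟨Submodule.mkQ _ w, rfl⟩)
    _ ≤ Module.length A (∀ j, Q j) :=
        Module.length_le_of_injective ((LinearMap.ker Ψ).liftQ Ψ le_rfl)
          (LinearMap.ker_eq_bot.1 (Submodule.ker_liftQ_eq_bot _ _ _ le_rfl))
    _ = hilbertSamuel A A T := by
        rw [Module.length_pi_of_fintype, hilbertSamuel_eq_sum]

theorem coeff_pow_mul_pow_mul_pow_eq_zero {r₁ r₂ r₃ : Rees A} {D : ℕ}
    (h₁ : ∀ n, D ≤ n → r₁.coeff n = 0) (h₂ : ∀ n, D ≤ n → r₂.coeff n = 0)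
    (h₃ : ∀ n, D ≤ n → r₃.coeff n = 0) {a b c m : ℕ} (ha : a < m) (hb : b < m) (hc : c < m)
    (n : ℕ) (hn : 3 * m * D + 1 ≤ n) : Rees.coeff n (r₁ ^ a * r₂ ^ b * r₃ ^ c) = 0 := by
  let φ : Rees A →+* Polynomial A := (reesAlgebra (maximalIdeal A)).toSubring.subtype
  have hd : ∀ r : Rees A, (∀ n, D ≤ n → r.coeff n = 0) → (φ r).natDegree ≤ D := fun r hr =>
    Polynomial.natDegree_le_iff_coeff_eq_zero.2 fun N hN => hr N hN.le
  have hp : ∀ r : Rees A, (∀ n, D ≤ n → r.coeff n = 0) → ∀ k < m, (φ r ^ k).natDegree ≤ m * D :=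
    fun r hr k hk => Polynomial.natDegree_pow_le.trans (Nat.mul_le_mul hk.le (hd r hr))
  change (φ (r₁ ^ a * r₂ ^ b * r₃ ^ c)).coeff n = 0
  apply Polynomial.coeff_eq_zero_of_natDegree_lt
  rw [map_mul, map_mul, map_pow, map_pow, map_pow]
  have h4 := hp r₁ h₁ a ha
  have h5 := hp r₂ h₂ b hb
  have h6 := hp r₃ h₃ c hc
  have h7 := (Polynomial.natDegree_mul_le (p := φ r₁ ^ a * φ r₂ ^ b) (q := φ r₃ ^ c))
  have h8 := (Polynomial.natDegree_mul_le (p := φ r₁ ^ a) (q := φ r₂ ^ b))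
  have h9 : 3 * m * D = m * D + m * D + m * D := by ring
  omega

/-- A regular sequence of length three in the irrelevant ideal forces cubic growth of the
Hilbert-Samuel function. -/
theorem exists_cube_le_hilbertSamuel {f₁ f₂ f₃ : AssocGradedRing A} (h₁ : f₁ ∈ irrelevant A)
    (h₂ : f₂ ∈ irrelevant A) (h₃ : f₃ ∈ irrelevant A)
    (h : IsWeaklyRegular (AssocGradedRing A) [f₁, f₂, f₃]) :
    ∃ D : ℕ, ∀ m : ℕ, ((m ^ 3 : ℕ) : ℕ∞) ≤ hilbertSamuel A A (3 * m * D + 1) := by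
  obtain ⟨r₁, rfl⟩ := AssocGradedRing.mk_surjective f₁
  obtain ⟨r₂, rfl⟩ := AssocGradedRing.mk_surjective f₂
  obtain ⟨r₃, rfl⟩ := AssocGradedRing.mk_surjective f₃
  set f₁ := AssocGradedRing.mk r₁
  set f₂ := AssocGradedRing.mk r₂
  set f₃ := AssocGradedRing.mk r₃
  obtain ⟨D₁, hD₁⟩ := r₁.exists_forall_coeff_eq_zero
  obtain ⟨D₂, hD₂⟩ := r₂.exists_forall_coeff_eq_zero
  obtain ⟨D₃, hD₃⟩ := r₃.exists_forall_coeff_eq_zero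
  have hreg := h.regular_mod_prev
  have hf₁ : ∀ u, f₁ * u ∈ (⊥ : Ideal (AssocGradedRing A)) → u ∈ (⊥ : Ideal _) := by
    have := (isSMulRegular_quotient_iff_mem_of_smul_mem _ _).1 (hreg 0 (by simp))
    simpa using this
  have hf₂ : ∀ u, f₂ * u ∈ Ideal.span {f₁} → u ∈ Ideal.span {f₁} := by
    have := (isSMulRegular_quotient_iff_mem_of_smul_mem _ _).1 (hreg 1 (by simp))
    simpa using this
  have hf₃ : ∀ u, f₃ * u ∈ Ideal.span {f₁} ⊔ Ideal.span {f₂} →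
      u ∈ Ideal.span {f₁} ⊔ Ideal.span {f₂} := by
    have := (isSMulRegular_quotient_iff_mem_of_smul_mem _ _).1 (hreg 2 (by simp))
    simpa using this
  let κ : A → AssocGradedRing A := fun a => AssocGradedRing.mk (algebraMap A (Rees A) a)
  have hκ0 : ∀ a, κ a = 0 → a ∈ maximalIdeal A := fun a ha => by
    have := AssocGradedRing.mk_eq_zero.1 ha 0
    have h1 := Rees.coeff_algebraMap_mul 0 a 1
    rw [mul_one, Rees.coeff_one] at h1
    rw [h1] at this
    simpa using this
  have hκ : ∀ a, κ a ∈ irrelevant A → κ a = 0 := fun a ha => by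
    have h2 := AssocGradedRing.mk_mem_irrelevant.1 ha
    have h1 := fun n => Rees.coeff_algebraMap_mul n a 1
    simp only [mul_one, Rees.coeff_one] at h1
    rw [h1] at h2
    rw [AssocGradedRing.mk_eq_zero]
    intro n
    rw [h1]
    split_ifs with hn
    · subst hn; simpa using h2
    · simp
  have hle : ∀ {f}, f ∈ irrelevant A → Ideal.span {f} ≤ irrelevant A := fun hf =>
    (Ideal.span_singleton_le_iff_mem _).2 hf
  refine ⟨max D₁ (max D₂ D₃), fun m => ?_⟩
  have hcard : m ^ 3 = Fintype.card (Fin m × Fin m × Fin m) := by simp; ring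
  rw [hcard]
  refine card_le_hilbertSamuel
    (fun i : Fin m × Fin m × Fin m => r₁ ^ (i.1 : ℕ) * r₂ ^ (i.2.1 : ℕ) * r₃ ^ (i.2.2 : ℕ)) ?_ ?_
  · rintro ⟨a, b, c⟩ n hn
    exact coeff_pow_mul_pow_mul_pow_eq_zero (fun n h => hD₁ n (le_trans (by simp) h))
      (fun n h => hD₂ n (le_trans (by simp) h)) (fun n h => hD₃ n (le_trans (by simp) h))
      a.2 b.2 c.2 n hn
  · intro w hw
    -- Extension by zero, so that the coefficients can be indexed by ranges of naturals.
    let w' : ℕ → ℕ → ℕ → A := fun a b c =>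
      if h : a < m ∧ b < m ∧ c < m then w (⟨a, h.1⟩, ⟨b, h.2.1⟩, ⟨c, h.2.2⟩) else 0
    have hww : ∀ a b c : Fin m, w (a, b, c) = w' a b c := fun a b c => by
      simp [w']
    let V₃ : Set (AssocGradedRing A) := Set.range κ
    let s₃ : (ℕ → A) → AssocGradedRing A := fun v => ∑ c ∈ Finset.range m, f₃ ^ c * κ (v c)
    let s₂ : (ℕ → ℕ → A) → AssocGradedRing A := fun v => ∑ b ∈ Finset.range m, f₂ ^ b * s₃ (v b)
    -- Independence is peeled off from the inside: powers of `f₃` over the residue field modulo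
    -- `(f₁, f₂)`, then powers of `f₂` over those sums modulo `(f₁)`, then powers of `f₁`. Each
    -- stage supplies the condition on `V` for the next.
    have key₃ : ∀ v, s₃ v ∈ Ideal.span {f₁} ⊔ Ideal.span {f₂} → ∀ c < m, κ (v c) = 0 := fun v hv =>
      eq_zero_of_sum_pow_mul_mem hf₃ V₃ (by
        rintro _ ⟨a, rfl⟩ ha
        exact hκ a (sup_le (sup_le (hle h₁) (hle h₂)) (hle h₃) ha)) (fun c _ => ⟨v c, rfl⟩) hv
    have key₂ : ∀ v, s₂ v ∈ Ideal.span {f₁} → ∀ b < m, s₃ (v b) = 0 := fun v hv =>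
      eq_zero_of_sum_pow_mul_mem hf₂ (Set.range s₃) (by
        rintro _ ⟨a, rfl⟩ ha
        exact Finset.sum_eq_zero fun c hc => by
          rw [key₃ a ha c (Finset.mem_range.1 hc), mul_zero]) (fun b _ => ⟨v b, rfl⟩) hv
    have key₁ : ∑ a ∈ Finset.range m, f₁ ^ a * s₂ (w' a) ∈ (⊥ : Ideal (AssocGradedRing A)) →
        ∀ a < m, s₂ (w' a) = 0 := fun hv =>
      eq_zero_of_sum_pow_mul_mem hf₁ (Set.range s₂) (by
        rintro _ ⟨a, rfl⟩ ha
        rw [bot_sup_eq] at ha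
        exact Finset.sum_eq_zero fun b hb => by
          rw [key₂ a ha b (Finset.mem_range.1 hb), mul_zero]) (fun a _ => ⟨w' a, rfl⟩) hv
    have hsum : ∑ a ∈ Finset.range m, f₁ ^ a * s₂ (w' a) = 0 := by
      rw [← hw, map_sum, Fintype.sum_prod_type, Finset.sum_range]
      refine Finset.sum_congr rfl fun a _ => ?_
      rw [Fintype.sum_prod_type, Finset.mul_sum, Finset.sum_range]
      refine Finset.sum_congr rfl fun b _ => ?_
      rw [Finset.mul_sum, Finset.mul_sum, Finset.sum_range]
      refine Finset.sum_congr rfl fun c _ => ?_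
      rw [map_mul, map_mul, map_mul, map_pow, map_pow, map_pow, hww]
      ring
    rintro ⟨a, b, c⟩
    rw [hww]
    refine hκ0 _ (key₃ _ ?_ c c.2)
    rw [key₂ _ ?_ b b.2]
    · exact zero_mem _
    · rw [key₁ (by rw [hsum]; exact zero_mem _) a a.2]
      exact zero_mem _

/-- If `A` is Cohen-Macaulay of dimension two and `G(A)` is Cohen-Macaulay, then `G(A)` has
dimension two. -/
theorem ringKrullDim_assocGradedRing [IsNoetherianRing A] (hdim : ringKrullDim A = 2)
    (hdepth : 2 ≤ depth (maximalIdeal A) A)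
    (hG : IsGradedCohenMacaulay A (AssocGradedRing A)) :
    ringKrullDim (AssocGradedRing A) = 2 := by
  obtain ⟨C, N, hCN⟩ := exists_hilbertSamuel_bounds hdim hdepth
  have hG' : (depth (irrelevant A) (AssocGradedRing A) : WithBot ℕ∞) =
      ringKrullDim (AssocGradedRing A) := by
    rw [← Module.supportDim_self_eq_ringKrullDim]; exact hG
  set δ := depth (irrelevant A) (AssocGradedRing A) with hδ
  rw [← hG']
  suffices hδ2 : δ = 2 by rw [hδ2]; rfl
  apply le_antisymm
  · by_contra hlt
    have h3 : ((3 : ℕ) : ℕ∞) ≤ δ := by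
      have := Order.add_one_le_of_lt (not_le.1 hlt)
      exact_mod_cast this
    obtain ⟨rs, hrs, hmem, hlen⟩ := exists_isWeaklyRegular_of_le_depth h3
    obtain ⟨f₁, f₂, f₃, rfl⟩ := List.length_eq_three.1 hlen
    obtain ⟨D, hD⟩ := exists_cube_le_hilbertSamuel (hmem f₁ (by simp)) (hmem f₂ (by simp))
      (hmem f₃ (by simp)) hrs
    -- Chosen to contradict `m³ ≤ (3mD + 1)²C ≤ m²(3D + 1)²C`.
    let m := (3 * D + 1) ^ 2 * C + 1
    have h4 := (hD m).trans (hCN (3 * m * D + 1) (by omega)).1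
    have h5 : m ^ 3 ≤ (3 * m * D + 1) ^ 2 * C := by exact_mod_cast h4
    have h6 : 3 * m * D + 1 ≤ m * (3 * D + 1) := by
      have : 1 ≤ m := by omega
      nlinarith
    have h7 : m ^ 3 ≤ m ^ 2 * ((3 * D + 1) ^ 2 * C) := by
      refine h5.trans ?_
      calc (3 * m * D + 1) ^ 2 * C ≤ (m * (3 * D + 1)) ^ 2 * C :=
            Nat.mul_le_mul_right _ (Nat.pow_le_pow_left h6 2)
        _ = _ := by ring
    have h8 : m ^ 2 * m ≤ m ^ 2 * ((3 * D + 1) ^ 2 * C) := by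
      rwa [← pow_succ]
    have h9 := Nat.le_of_mul_le_mul_left h8 (by positivity)
    omega
  · by_contra hlt
    have hle1 : δ ≤ 1 := Order.le_of_lt_add_one (by exact_mod_cast not_le.1 hlt)
    -- The factor `n + 1` covers both cases: a constant bound if `G(A)` is Artinian, and
    -- `n·ℓ(G(A)/(f))` if `f` is a regular element with Artinian quotient.
    obtain ⟨ℓ, hℓ⟩ : ∃ ℓ : ℕ, ∀ n, hilbertSamuel A A n ≤ ((n + 1) * ℓ : ℕ) := by
      rcases eq_or_ne δ 0 with h0 | h0
      · have : IsArtinianRing (AssocGradedRing A) := by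
          rw [isArtinianRing_iff_krullDimLE_zero, Ring.krullDimLE_iff, ← hG', h0]
          rfl
        obtain ⟨ℓ, hℓ⟩ := ENat.ne_top_iff_exists.1
          (Module.length_ne_top (R := AssocGradedRing A) (M := AssocGradedRing A))
        refine ⟨ℓ, fun n => (hilbertSamuel_le_length_quotient_irrelevant_pow n).trans ?_⟩
        refine (Module.length_le_of_surjective _ (Submodule.mkQ_surjective _)).trans ?_
        rw [← hℓ]
        exact_mod_cast Nat.le_mul_of_pos_left ℓ (by omega)
      · have h1 : ((1 : ℕ) : ℕ∞) ≤ δ := Order.one_le_iff_pos.2 (pos_iff_ne_zero.2 h0)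
        obtain ⟨rs, hrs, hmem, hlen⟩ := exists_isWeaklyRegular_of_le_depth h1
        obtain ⟨f, rfl⟩ := List.length_eq_one_iff.1 hlen
        have hf := (isWeaklyRegular_singleton_iff _ _).1 hrs
        have hfirr := hmem f (by simp)
        have hnzd : f ∈ nonZeroDivisors (AssocGradedRing A) := by
          rw [mem_nonZeroDivisors_iff_right]
          intro z hz
          exact hf.right_eq_zero_of_smul (by rw [smul_eq_mul, mul_comm, hz])
        have hdimf := ringKrullDim_quotient_succ_le_of_nonZeroDivisor hnzd
        have hdimf' : ringKrullDim (AssocGradedRing A ⧸ Ideal.span {f}) + 1 ≤ 0 + 1 := by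
          rw [zero_add]
          refine hdimf.trans ?_
          rw [← hG']
          exact_mod_cast hle1
        have : IsArtinianRing (AssocGradedRing A ⧸ Ideal.span {f}) := by
          rw [isArtinianRing_iff_krullDimLE_zero, Ring.krullDimLE_iff]
          exact (ENat.WithBot.add_le_add_one_right_iff).1 hdimf'
        have hfin : Module.length (AssocGradedRing A) (AssocGradedRing A ⧸ Ideal.span {f}) ≠ ⊤ := by
          rw [Module.length_eq_of_surjective (R := AssocGradedRing A ⧸ Ideal.span {f})
            Ideal.Quotient.mk_surjective]
          exact Module.length_ne_top
        obtain ⟨ℓ, hℓ⟩ := ENat.ne_top_iff_exists.1 hfin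
        refine ⟨ℓ, fun n => (hilbertSamuel_le_length_quotient_irrelevant_pow n).trans ?_⟩
        have hle : Ideal.span {f ^ n} ≤ irrelevant A ^ n :=
          (Ideal.span_singleton_le_iff_mem _).2 (Ideal.pow_mem_pow hfirr n)
        refine (Module.length_le_of_surjective _ (Submodule.factor_surjective hle)).trans ?_
        have hf' : IsSMulRegular (AssocGradedRing A ⧸ (⊥ : Ideal (AssocGradedRing A))) f :=
          (LinearEquiv.isSMulRegular_congr (Submodule.quotEquivOfEqBot _ rfl) f).2 hf
        have hlen := length_quotient_sup_span_pow hf' n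
        rw [bot_sup_eq, bot_sup_eq, ← hℓ] at hlen
        rw [hlen]
        exact_mod_cast Nat.mul_le_mul_right ℓ (Nat.le_succ n)
    -- Chosen to contradict `n² ≤ (Nn + 1)ℓ ≤ n(N + 1)ℓ`.
    let n := (N + 1) * ℓ + 1
    have h4 := (hCN n (by omega)).2.trans (hℓ (N * n))
    have h5 : n ^ 2 ≤ (N * n + 1) * ℓ := by exact_mod_cast h4
    have h6 : (N * n + 1) * ℓ ≤ n * ((N + 1) * ℓ) := by
      calc (N * n + 1) * ℓ ≤ (N * n + n) * ℓ := Nat.mul_le_mul_right _ (by omega)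
        _ = _ := by ring
    have h7 := Nat.le_of_mul_le_mul_left ((pow_two n ▸ h5).trans h6) (by omega)
    omega

end Dimension

/-! ### The degree one embedding of `G(M)` into a free `G(A)`-module. -/

section GradedSyzygy

theorem mem_smul_top_pi_iff {R : Type*} [CommRing R] {ι : Type*} [Finite ι] (I : Ideal R)
    {u : ι → R} : u ∈ (I • ⊤ : Submodule R (ι → R)) ↔ ∀ i, u i ∈ I := by
  classical
  have := Fintype.ofFinite ι
  constructor
  · intro hu i
    have h1 := Submodule.mem_map_of_mem (f := LinearMap.proj i) hu
    rw [Submodule.map_smul''] at h1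
    have h2 := Submodule.smul_mono le_rfl (le_top (a := Submodule.map (LinearMap.proj i) ⊤)) h1
    simpa using h2
  · intro hu
    rw [pi_eq_sum_univ u]
    exact Submodule.sum_mem _ fun i _ => Submodule.smul_mem_smul (hu i) trivial

variable {A : Type u} [CommRing A] [IsLocalRing A] {M : Type u} [AddCommGroup M] [Module A M]

theorem apply_mem_pow_succ (φ : M →ₗ[A] A) (hφ : ∀ m, φ m ∈ maximalIdeal A) {n : ℕ} {m : M}
    (hm : m ∈ (maximalIdeal A ^ n • ⊤ : Submodule A M)) : φ m ∈ maximalIdeal A ^ (n + 1) := by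
  have h1 := Submodule.mem_map_of_mem (f := φ) hm
  rw [Submodule.map_smul''] at h1
  have h2 : Submodule.map φ ⊤ ≤ maximalIdeal A := by
    rintro _ ⟨m, -, rfl⟩
    exact hφ m
  have h3 := Submodule.smul_mono le_rfl h2 h1
  rwa [smul_eq_mul, ← pow_succ] at h3

/-- The map `⨁ 𝔪 ^ n M t ^ n → ⨁ 𝔪 ^ n t ^ n` of degree one induced by a linear form on `M` with
values in `𝔪`. -/
def ReesModule.shift (φ : M →ₗ[A] A) (hφ : ∀ m, φ m ∈ maximalIdeal A) (p : ReesModule A M) :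
    Rees A :=
  ∑ n ∈ Finset.range p.exists_forall_coeff_eq_zero.choose,
    Rees.monomial (n + 1) (φ (p.coeff n)) (apply_mem_pow_succ φ hφ (p.coeff_mem n))

theorem ReesModule.coeff_succ_shift (φ : M →ₗ[A] A) (hφ : ∀ m, φ m ∈ maximalIdeal A)
    (p : ReesModule A M) (n : ℕ) : Rees.coeff (n + 1) (shift φ hφ p) = φ (p.coeff n) := by
  rw [shift, Rees.coeff_sum]
  simp only [Rees.coeff_monomial, add_left_inj, Finset.sum_ite_eq', Finset.mem_range]
  split_ifs with h
  · rfl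
  · rw [p.exists_forall_coeff_eq_zero.choose_spec n (not_lt.1 h), map_zero]

theorem ReesModule.coeff_zero_shift (φ : M →ₗ[A] A) (hφ : ∀ m, φ m ∈ maximalIdeal A)
    (p : ReesModule A M) : Rees.coeff 0 (shift φ hφ p) = 0 := by
  rw [shift, Rees.coeff_sum]
  simp [Rees.coeff_monomial]

theorem ReesModule.shift_add (φ : M →ₗ[A] A) (hφ : ∀ m, φ m ∈ maximalIdeal A)
    (p q : ReesModule A M) : shift φ hφ (p + q) = shift φ hφ p + shift φ hφ q := by
  refine Rees.ext fun n => ?_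
  rcases n with _ | n
  · simp [Rees.coeff_add, coeff_zero_shift]
  · simp [Rees.coeff_add, coeff_succ_shift, coeff_add]

theorem ReesModule.shift_smul (φ : M →ₗ[A] A) (hφ : ∀ m, φ m ∈ maximalIdeal A)
    (r : Rees A) (p : ReesModule A M) : shift φ hφ (r • p) = r * shift φ hφ p := by
  refine Rees.ext fun n => ?_
  rcases n with _ | n
  · simp [Rees.coeff_mul, coeff_zero_shift]
  · rw [Rees.coeff_mul, coeff_succ_shift, coeff_smul, map_sum, Finset.Nat.antidiagonal_succ']
    simp [coeff_zero_shift, coeff_succ_shift]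

theorem AssocGraded.exists_shift (φ : M →ₗ[A] A) (hφ : ∀ m, φ m ∈ maximalIdeal A) :
    ∃ Φ : AssocGraded A M →ₗ[AssocGradedRing A] AssocGradedRing A,
      ∀ p, Φ (mk p) = AssocGradedRing.mk (ReesModule.shift φ hφ p) := by
  let g : ReesModule A M →+ AssocGradedRing A := AddMonoidHom.mk'
    (fun p => AssocGradedRing.mk (ReesModule.shift φ hφ p)) fun p q => by
      rw [ReesModule.shift_add, map_add]
  have hg : (mk (A := A) (M := M)).ker ≤ g.ker := by
    intro p hp
    rw [AddMonoidHom.mem_ker, mk_eq_zero] at hp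
    change AssocGradedRing.mk _ = 0
    rw [AssocGradedRing.mk_eq_zero]
    intro n
    rcases n with _ | n
    · rw [ReesModule.coeff_zero_shift]; exact zero_mem _
    · rw [ReesModule.coeff_succ_shift]; exact apply_mem_pow_succ φ hφ (hp n)
  let Φ : AssocGraded A M →+ AssocGradedRing A := (mk (A := A) (M := M)).liftOfRightInverse _
    (Function.rightInverse_surjInv mk_surjective) ⟨g, hg⟩
  have hΦ : ∀ p, Φ (mk p) = AssocGradedRing.mk (ReesModule.shift φ hφ p) := fun p =>
    AddMonoidHom.liftOfRightInverse_comp_apply _ _ _ ⟨g, hg⟩ p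
  refine ⟨{ Φ with map_smul' := ?_ }, hΦ⟩
  intro r z
  obtain ⟨r, rfl⟩ := AssocGradedRing.mk_surjective r
  obtain ⟨p, rfl⟩ := mk_surjective z
  change Φ _ = AssocGradedRing.mk r * Φ _
  rw [mk_smul_mk, hΦ, hΦ, ReesModule.shift_smul, map_mul]

/-- `G(A)` need not be local, so properness of the irrelevant multiple of `G(M)` is read off in
degree zero, where it reduces to Nakayama for `M` over `A`. -/
theorem AssocGraded.coeff_zero_mem_of_mk_mem {p : ReesModule A M}
    (h : mk p ∈ (irrelevant A • ⊤ : Submodule (AssocGradedRing A) (AssocGraded A M))) :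
    p.coeff 0 ∈ (maximalIdeal A • ⊤ : Submodule A M) := by
  generalize hz : mk p = z at h
  induction h using Submodule.smul_induction_on' generalizing p with
  | smul r hr w hw =>
    obtain ⟨r, rfl⟩ := AssocGradedRing.mk_surjective r
    obtain ⟨q, rfl⟩ := mk_surjective w
    rw [mk_smul_mk, ← sub_eq_zero, ← map_sub, mk_eq_zero] at hz
    have h0 := hz 0
    rw [zero_add, pow_one] at h0
    rw [sub_eq_add_neg, ReesModule.coeff_add] at h0
    have h1 : ReesModule.coeff 0 (r • q) ∈ (maximalIdeal A • ⊤ : Submodule A M) := by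
      rw [ReesModule.coeff_smul]
      simpa using Submodule.smul_mem_smul (AssocGradedRing.mk_mem_irrelevant.1 hr)
        (Submodule.mem_top (x := q.coeff 0))
    have h2 : ReesModule.coeff 0 (-(r • q)) = - ReesModule.coeff 0 (r • q) := by
      rw [eq_neg_iff_add_eq_zero, ← ReesModule.coeff_add, neg_add_cancel, ReesModule.coeff_zero]
    rw [h2, ← sub_eq_add_neg] at h0
    simpa using add_mem h0 h1
  | add x hx y hy ihx ihy =>
    obtain ⟨q, rfl⟩ := mk_surjective x
    obtain ⟨q', rfl⟩ := mk_surjective y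
    have h1 := ihx rfl
    have h2 := ihy rfl
    rw [← map_add, ← sub_eq_zero, ← map_sub, mk_eq_zero] at hz
    have h0 := hz 0
    rw [zero_add, pow_one] at h0
    have h3 : ReesModule.coeff 0 p = ReesModule.coeff 0 (p - (q + q')) +
        (ReesModule.coeff 0 q + ReesModule.coeff 0 q') := by
      rw [← ReesModule.coeff_add, ← ReesModule.coeff_add, sub_add_cancel]
    rw [h3]
    exact add_mem h0 (add_mem h1 h2)

theorem AssocGraded.top_ne_irrelevant_smul [Module.Finite A M] [Nontrivial M] :
    ⊤ ≠ (irrelevant A • ⊤ : Submodule (AssocGradedRing A) (AssocGraded A M)) := by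
  intro h
  have h1 : (⊤ : Submodule A M) = maximalIdeal A • ⊤ := by
    refine le_antisymm (fun m _ => ?_) le_top
    have hm : m ∈ (maximalIdeal A ^ 0 • ⊤ : Submodule A M) := by simp
    have h2 := coeff_zero_mem_of_mk_mem (p := ReesModule.single 0 m hm) (by
      rw [← h]; trivial)
    simpa [ReesModule.coeff_single] using h2
  exact Submodule.top_ne_ideal_smul_of_le_jacobson_annihilator
    (IsLocalRing.maximalIdeal_le_jacobson _) h1

instance AssocGraded.instNontrivial [Module.Finite A M] [Nontrivial M] :
    Nontrivial (AssocGraded A M) := by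
  by_contra h
  rw [not_nontrivial_iff_subsingleton] at h
  exact top_ne_irrelevant_smul (A := A) (M := M) (Subsingleton.elim _ _)

theorem isWeaklyRegular_of_flat {R : Type*} [CommRing R] {rs : List R} (h : IsWeaklyRegular R rs)
    (N : Type*) [AddCommGroup N] [Module R N] [Module.Flat R N] : IsWeaklyRegular N rs :=
  ((TensorProduct.rid R N).isWeaklyRegular_congr rs).1 h.isWeaklyRegular_lTensor

/-- A submodule `M` of a free module `F` with `M ⊆ 𝔪 F` and `M ∩ 𝔪 ^ (n + 1) F = 𝔪 ^ n M`, such that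
the associated graded module of `F ⧸ M` has positive depth. -/
theorem exists_isWeaklyRegular_pair_assocGraded [IsNoetherianRing A] [Module.Finite A M] {d : ℕ}
    (ι : M →ₗ[A] Fin d → A) (hι : ∀ m i, ι m i ∈ maximalIdeal A)
    (hpow : ∀ n m, (∀ i, ι m i ∈ maximalIdeal A ^ (n + 1)) →
      m ∈ (maximalIdeal A ^ n • ⊤ : Submodule A M))
    (htor : ∀ n, ∀ u ∈ (maximalIdeal A ^ n • ⊤ : Submodule A (Fin d → A)),
      (∀ a ∈ maximalIdeal A, a • u ∈ LinearMap.range ι ⊔ (maximalIdeal A ^ (n + 2) • ⊤)) →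
      u ∈ LinearMap.range ι ⊔ (maximalIdeal A ^ (n + 1) • ⊤))
    {a b : AssocGradedRing A} (ha : a ∈ irrelevant A) (hb : b ∈ irrelevant A)
    (hab : IsWeaklyRegular (AssocGradedRing A) [a, b]) :
    ∃ f ∈ irrelevant A, ∃ g ∈ irrelevant A, IsWeaklyRegular (AssocGraded A M) [f, g] := by
  let φ : Fin d → M →ₗ[A] A := fun i => LinearMap.proj i ∘ₗ ι
  have hφ : ∀ i m, φ i m ∈ maximalIdeal A := fun i m => hι m i
  choose Φ hΦ using fun i => AssocGraded.exists_shift (φ i) (hφ i)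
  let Ψ : AssocGraded A M →ₗ[AssocGradedRing A] Fin d → AssocGradedRing A := LinearMap.pi Φ
  -- `Ψ` raises degrees by one: a class in degree `n` dies when its image lies in `𝔪ⁿ⁺²F`, and then
  -- `hpow` puts it in `𝔪ⁿ⁺¹M`.
  have hΨ : Function.Injective Ψ := by
    rw [injective_iff_map_eq_zero]
    intro z hz
    obtain ⟨p, rfl⟩ := AssocGraded.mk_surjective z
    rw [AssocGraded.mk_eq_zero]
    intro n
    refine hpow (n + 1) _ fun i => ?_
    have h1 : Φ i (AssocGraded.mk p) = 0 := congrFun hz i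
    rw [hΦ, AssocGradedRing.mk_eq_zero] at h1
    have h2 := h1 (n + 1)
    rwa [ReesModule.coeff_succ_shift] at h2
  -- The condition on the right describes the kernel of `G(F) → G(F/M)`, so the cokernel of `Ψ`
  -- embeds in `G(F/M)`.
  have hrange : ∀ r : Fin d → Rees A, (fun i => AssocGradedRing.mk (r i)) ∈ LinearMap.range Ψ ↔
      ∀ n, (fun i => (r i).coeff n) ∈ LinearMap.range ι ⊔ (maximalIdeal A ^ (n + 1) • ⊤) := by
    intro r
    constructor
    · rintro ⟨z, hz⟩ n
      obtain ⟨p, rfl⟩ := AssocGraded.mk_surjective z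
      have h1 : ∀ i, (ReesModule.shift (φ i) (hφ i) p - r i).coeff n ∈
          maximalIdeal A ^ (n + 1) := fun i => by
        have h2 : Φ i (AssocGraded.mk p) = AssocGradedRing.mk (r i) := congrFun hz i
        rw [hΦ, ← sub_eq_zero, ← map_sub, AssocGradedRing.mk_eq_zero] at h2
        exact h2 n
      simp only [Rees.coeff_sub] at h1
      rcases n with _ | n
      · simp only [ReesModule.coeff_zero_shift, zero_sub, neg_mem_iff] at h1
        exact Submodule.mem_sup_right ((mem_smul_top_pi_iff _).2 h1)
      · simp only [ReesModule.coeff_succ_shift] at h1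
        have h3 := sub_mem (Submodule.mem_sup_left (LinearMap.mem_range_self ι (p.coeff n)))
          (Submodule.mem_sup_right (S := LinearMap.range ι) ((mem_smul_top_pi_iff _).2 h1))
        convert h3 using 1
        funext i
        simp [φ]
    · intro h
      have hdec : ∀ n, ∃ m : M, ∀ i, (r i).coeff (n + 1) - ι m i ∈ maximalIdeal A ^ (n + 2) := by
        intro n
        obtain ⟨_, ⟨m, rfl⟩, w, hw, hmw⟩ := Submodule.mem_sup.1 (h (n + 1))
        refine ⟨m, fun i => ?_⟩
        have := (mem_smul_top_pi_iff _).1 hw i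
        rw [← congrFun hmw i]
        simpa using this
      choose m hm using hdec
      have hm' : ∀ n, m n ∈ (maximalIdeal A ^ n • ⊤ : Submodule A M) := fun n =>
        hpow n _ fun i => by
          have := sub_mem ((r i).coeff_mem (n + 1))
            (Ideal.pow_le_pow_right (Nat.le_succ (n + 1)) (hm n i))
          simpa using this
      choose D hD using fun i => (r i).exists_forall_coeff_eq_zero
      let D' := ∑ i, D i
      have hD' : ∀ i n, D' ≤ n → (r i).coeff n = 0 := fun i n hn =>
        hD i n ((Finset.single_le_sum (fun _ _ => Nat.zero_le _) (Finset.mem_univ i)).trans hn)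
      refine ⟨AssocGraded.mk (∑ n ∈ Finset.range D', ReesModule.single n (m n) (hm' n)), ?_⟩
      funext i
      change Φ i _ = _
      rw [hΦ, ← sub_eq_zero, ← map_sub, AssocGradedRing.mk_eq_zero]
      intro n
      rw [Rees.coeff_sub]
      rcases n with _ | n
      · rw [ReesModule.coeff_zero_shift, zero_sub, neg_mem_iff]
        have h0 : LinearMap.range ι ⊔ (maximalIdeal A ^ (0 + 1) • ⊤) ≤
            (maximalIdeal A ^ (0 + 1) • ⊤ : Submodule A (Fin d → A)) := by
          refine sup_le ?_ le_rfl
          rintro _ ⟨m, rfl⟩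
          rw [mem_smul_top_pi_iff]
          simpa using hι m
        exact (mem_smul_top_pi_iff _).1 (h0 (h 0)) i
      · rw [ReesModule.coeff_succ_shift, ReesModule.coeff_sum]
        simp only [ReesModule.coeff_single, Finset.sum_ite_eq', Finset.mem_range]
        split_ifs with hn
        · rw [← neg_mem_iff, neg_sub]
          exact hm n i
        · rw [hD' i (n + 1) (by omega)]
          simp
  refine exists_isWeaklyRegular_pair_of_exact Ψ (LinearMap.range Ψ).mkQ hΨ
    (LinearMap.exact_map_mkQ_range Ψ) ha hb (isWeaklyRegular_of_flat hab _) ?_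
  -- Testing against `ct` with `c ∈ 𝔪` suffices: the coefficient of `ct·r` in degree `n + 1` is `c`
  -- times that of `r` in degree `n`, as `htor` requires.
  intro z hz
  obtain ⟨z, rfl⟩ := Submodule.mkQ_surjective _ z
  choose r hr using fun i => AssocGradedRing.mk_surjective (z i)
  obtain rfl : z = fun i => AssocGradedRing.mk (r i) := funext fun i => (hr i).symm
  rw [Submodule.mkQ_apply, Submodule.Quotient.mk_eq_zero, hrange]
  intro n
  refine htor n _ ((mem_smul_top_pi_iff _).2 fun i => (r i).coeff_mem n) fun c hc => ?_
  have hc1 : c ∈ maximalIdeal A ^ 1 := by simpa using hc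
  have h1 := hz (AssocGradedRing.mk (Rees.monomial 1 c hc1))
    (AssocGradedRing.mk_mem_irrelevant.2 (by simp [Rees.coeff_monomial]))
  rw [← map_smul, Submodule.mkQ_apply, Submodule.Quotient.mk_eq_zero] at h1
  have h2 : (AssocGradedRing.mk (Rees.monomial 1 c hc1) • fun i => AssocGradedRing.mk (r i)) =
      fun i => AssocGradedRing.mk (Rees.monomial 1 c hc1 * r i) := by
    funext i
    simp
  rw [h2, hrange] at h1
  have h3 := h1 (n + 1)
  convert h3 using 2 with i
  rw [Rees.coeff_mul, Finset.sum_eq_single (1, n)]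
  · simp [Rees.coeff_monomial]
  · rintro ⟨k, l⟩ hkl hne
    have hkl' := Finset.HasAntidiagonal.mem_antidiagonal.1 hkl
    rw [Rees.coeff_monomial, if_neg, zero_mul]
    rintro rfl
    exact hne (by simp only [Prod.mk.injEq, true_and]; omega)
  · intro h
    exact absurd (Finset.HasAntidiagonal.mem_antidiagonal.2 (add_comm 1 n)) h

end GradedSyzygy

/-! ### Depth, graded depth and non-freeness of the syzygy. -/

section Syzygy

theorem hilbertSamuel_congr {A : Type*} [CommRing A] [IsLocalRing A] {E E' : Type*}
    [AddCommGroup E] [Module A E] [AddCommGroup E'] [Module A E'] (e : E ≃ₗ[A] E') (n : ℕ) :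
    hilbertSamuel A E n = hilbertSamuel A E' n :=
  (Submodule.Quotient.equiv _ _ e (by
    rw [Submodule.map_smul'', Submodule.map_top,
      LinearMap.range_eq_top.2 e.surjective])).length_eq

theorem hilbertSamuel_one_coe {A : Type*} [CommRing A] [IsLocalRing A]
    {E : Type*} [AddCommGroup E] [Module A E] {N : Submodule A E} (hN : N.FG) :
    hilbertSamuel A N 1 = N.spanFinrank := by
  have : Module.Finite A N := Module.Finite.iff_fg.2 hN
  rw [IsLocalRing.spanFinrank_eq_finrank_quotient _ hN, hilbertSamuel, pow_one]
  let _ : Field (A ⧸ maximalIdeal A) := Ideal.Quotient.field _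
  rw [Module.length_eq_of_surjective (R := A ⧸ maximalIdeal A) Ideal.Quotient.mk_surjective]
  exact Module.length_eq_finrank _ _

theorem hilbertSamuel_one_eq_spanFinrank {A : Type*} [CommRing A] [IsLocalRing A]
    {E : Type*} [AddCommGroup E] [Module A E] [Module.Finite A E] :
    hilbertSamuel A E 1 = (⊤ : Submodule A E).spanFinrank := by
  rw [← hilbertSamuel_congr (Submodule.topEquiv (R := A) (M := E)),
    hilbertSamuel_one_coe Module.Finite.fg_top]

theorem hilbertSamuel_eq_of_surjective {A B : Type*} [CommRing A] [IsLocalRing A] [CommRing B]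
    [IsLocalRing B] [Algebra A B] (h : Function.Surjective (algebraMap A B)) {E : Type*}
    [AddCommGroup E] [Module A E] [Module B E] [IsScalarTower A B E] (n : ℕ) :
    hilbertSamuel A E n = hilbertSamuel B E n := by
  have h1 : (maximalIdeal A ^ n • ⊤ : Submodule A E) =
      (maximalIdeal B ^ n • ⊤ : Submodule B E).restrictScalars A := by
    rw [← map_maximalIdeal_of_surjective _ h, ← Ideal.map_pow, Ideal.smul_restrictScalars,
      Submodule.restrictScalars_top]
  rw [hilbertSamuel, hilbertSamuel, h1, (Submodule.Quotient.restrictScalarsEquiv A _).length_eq,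
    Module.length_eq_of_surjective h]

theorem hilbertSamuel_pi {A : Type*} [CommRing A] [IsLocalRing A] (d n : ℕ) :
    hilbertSamuel A (Fin d → A) n = d * hilbertSamuel A A n := by
  have h1 : (maximalIdeal A ^ n • ⊤ : Submodule A (Fin d → A)) =
      Submodule.pi Set.univ fun _ => maximalIdeal A ^ n := by
    ext u
    rw [mem_smul_top_pi_iff, Submodule.mem_pi]
    simp
  rw [hilbertSamuel_self, hilbertSamuel, h1, (Submodule.quotientPi _).length_eq,
    Module.length_pi_of_fintype]
  simp

theorem hilbertSamuel_self_add {B : Type*} [CommRing B] [IsLocalRing B] (c k : ℕ) : hilbertSamuel B B (c + k) =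
    hilbertSamuel B (maximalIdeal B ^ c : Ideal B) k + hilbertSamuel B B c := by
  rw [hilbertSamuel_self, hilbertSamuel_self]
  have hle : maximalIdeal B ^ (c + k) ≤ maximalIdeal B ^ c := Ideal.pow_le_pow_right (by omega)
  have hmap : (maximalIdeal B ^ k • ⊤ : Submodule B (maximalIdeal B ^ c : Ideal B)) =
      Submodule.comap (Submodule.subtype (maximalIdeal B ^ c)) (maximalIdeal B ^ (c + k)) := by
    refine Submodule.map_injective_of_injective (Submodule.injective_subtype _) ?_
    rw [Submodule.map_smul'', Submodule.map_top, Submodule.range_subtype,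
      Submodule.map_comap_subtype, smul_eq_mul, ← pow_add, add_comm k c, inf_eq_right.2 hle]
  refine Module.length_eq_add_of_exact
    (Submodule.mapQ _ _ (Submodule.subtype (maximalIdeal B ^ c)) hmap.le)
    (Submodule.factor hle) ?_ (Submodule.factor_surjective hle) ?_
  · rw [← LinearMap.ker_eq_bot, Submodule.ker_mapQ, ← hmap, Submodule.mkQ_map_self]
  · rw [LinearMap.exact_iff, Submodule.range_mapQ, Submodule.range_subtype]
    exact Submodule.ker_mapQ _ _ _ _

theorem hilbertSamuel_self_two {A : Type*} [CommRing A] [IsLocalRing A] [IsNoetherianRing A] :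
    hilbertSamuel A A 2 = (maximalIdeal A).spanFinrank + hilbertSamuel A A 1 := by
  rw [hilbertSamuel_self_add 1 1,
    hilbertSamuel_one_coe (maximalIdeal A ^ 1).fg_of_isNoetherianRing, pow_one]

/-- The data on an Ulrich module of dimension one over a quotient ring that are used to study its
first syzygy: a regular element and a linear Hilbert-Samuel function. -/
theorem IsUlrich.exists_isSMulRegular {B : Type*} [CommRing B] [IsLocalRing B] [IsNoetherianRing B]
    (hB : ringKrullDim B = 1) {E : Type*} [AddCommGroup E] [Module B E] (h : IsUlrich B E) :
    (∃ y ∈ maximalIdeal B, IsSMulRegular E y) ∧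
      ∀ᶠ n in Filter.atTop, hilbertSamuel B E (n + 1) =
        hilbertSamuel B E n + hilbertSamuel B E 1 := by
  have := h.isMaximalCohenMacaulay.finite
  have := h.isMaximalCohenMacaulay.nontrivial
  have hdepth : depth (maximalIdeal B) E = 1 := by
    have := h.isMaximalCohenMacaulay.depth_eq
    rw [hB] at this
    exact_mod_cast this
  constructor
  · obtain ⟨rs, hrs, hmem, hlen⟩ := exists_isWeaklyRegular_of_le_depth (n := 1)
      (by rw [hdepth]; rfl)
    obtain ⟨y, rfl⟩ := List.length_eq_one_iff.1 hlen
    exact ⟨y, hmem y (by simp), (isWeaklyRegular_singleton_iff _ _).1 hrs⟩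
  · obtain ⟨r, P, hr, hP, hdeg, hlead⟩ := h.hasMultiplicity
    -- `dim E` is squeezed between `depth E = 1` and `dim B = 1`.
    have hr1 : r = 1 := by
      have h1 := depth_le_supportDim (N := E) (maximalIdeal B)
      have h2 := Module.supportDim_le_ringKrullDim B E
      rw [hdepth, hr] at h1
      rw [hB, hr] at h2
      have h1' : 1 ≤ r := by exact_mod_cast h1
      have h2' : r ≤ 1 := by exact_mod_cast h2
      omega
    subst hr1
    rw [Polynomial.leadingCoeff, hdeg, Nat.factorial_one, Nat.cast_one, mul_one] at hlead
    have hev : ∀ x : ℚ, P.eval (x + 1) = P.eval x + (⊤ : Submodule B E).spanFinrank := fun x => by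
      conv_lhs => rw [Polynomial.eq_X_add_C_of_natDegree_le_one hdeg.le]
      conv_rhs => rw [Polynomial.eq_X_add_C_of_natDegree_le_one hdeg.le]
      simp [hlead]
      ring
    obtain ⟨N, hN⟩ := Filter.eventually_atTop.1 hP
    refine Filter.eventually_atTop.2 ⟨N + 1, fun n hn => ?_⟩
    -- The Hilbert–Samuel polynomial at `k` gives the length modulo `𝔪^(k+1)`, whereas
    -- `hilbertSamuel` is indexed by the exponent itself.
    obtain ⟨n, rfl⟩ : ∃ k, n = k + 1 := ⟨n - 1, by omega⟩
    obtain ⟨l, hl, hPl⟩ := hN n (by omega)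
    obtain ⟨l', hl', hPl'⟩ := hN (n + 1) (by omega)
    rw [hilbertSamuel_one_eq_spanFinrank, hilbertSamuel, hilbertSamuel, hl, hl']
    rw [Nat.cast_add, Nat.cast_one, hev, hPl] at hPl'
    have : l + (⊤ : Submodule B E).spanFinrank = l' := by exact_mod_cast hPl'
    rw [← this]
    push_cast
    rfl

theorem isMaximalCohenMacaulay_of_isWeaklyRegular_pair {A : Type*} [CommRing A] [IsLocalRing A]
    [IsNoetherianRing A] (hdim : ringKrullDim A = 2) {M : Type*} [AddCommGroup M] [Module A M]
    [Module.Finite A M] [Nontrivial M] {f g : A} (hf : f ∈ maximalIdeal A)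
    (hg : g ∈ maximalIdeal A) (h : IsWeaklyRegular M [f, g]) : IsMaximalCohenMacaulay A M := by
  refine ⟨inferInstance, inferInstance, le_antisymm ?_ ?_⟩
  · exact (depth_le_supportDim _).trans (Module.supportDim_le_ringKrullDim A M)
  · have hmem : ∀ r ∈ [f, g], r ∈ maximalIdeal A := by
      rintro r hr
      rcases List.mem_pair.1 hr with rfl | rfl <;> assumption
    have h1 := le_depth_of_isRegular
      ((isRegular_iff_isWeaklyRegular_of_subset_maximalIdeal hmem).2 h) hmem
    rw [hdim]
    exact WithBot.coe_le_coe.2 h1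

theorem isGradedCohenMacaulay_of_isWeaklyRegular_pair {A : Type u} [CommRing A] [IsLocalRing A]
    [IsNoetherianRing A] (hdim : ringKrullDim (AssocGradedRing A) = 2) {M : Type u}
    [AddCommGroup M] [Module A M] [Module.Finite A M] [Nontrivial M] {f g : AssocGradedRing A}
    (hf : f ∈ irrelevant A) (hg : g ∈ irrelevant A) (h : IsWeaklyRegular (AssocGraded A M) [f, g]) :
    IsGradedCohenMacaulay A (AssocGraded A M) := by
  refine le_antisymm (depth_le_supportDim _) ?_
  refine (Module.supportDim_le_ringKrullDim _ _).trans ?_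
  have hmem : ∀ r ∈ [f, g], r ∈ irrelevant A := by
    rintro r hr
    rcases List.mem_pair.1 hr with rfl | rfl <;> assumption
  have hreg : IsRegular (AssocGraded A M) [f, g] := ⟨h, fun htop =>
    AssocGraded.top_ne_irrelevant_smul (A := A) (M := M) (le_antisymm
      (htop.le.trans (Submodule.smul_mono (Ideal.span_le.2 hmem) le_rfl)) le_top)⟩
  have h1 := le_depth_of_isRegular hreg hmem
  rw [hdim]
  exact WithBot.coe_le_coe.2 h1

variable {A : Type u} [CommRing A] [IsLocalRing A] [IsNoetherianRing A]
  {E : Type u} [AddCommGroup E] [Module A E] [Module.Finite A E]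
  {M : Type u} [AddCommGroup M] [Module A M] {d : ℕ}

theorem isMaximalCohenMacaulay_of_equiv_ker (hdim : ringKrullDim A = 2)
    (hdepth : 2 ≤ depth (maximalIdeal A) A) {y : A} (hy : y ∈ maximalIdeal A)
    (hyE : IsSMulRegular E y) (ε : (Fin d → A) →ₗ[A] E) (e : M ≃ₗ[A] LinearMap.ker ε)
    [Nontrivial M] : IsMaximalCohenMacaulay A M := by
  obtain ⟨rs, hrs, hmem, hlen⟩ := exists_isWeaklyRegular_of_le_depth (n := 2) hdepth
  obtain ⟨a, b, rfl⟩ := List.length_eq_two.1 hlen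
  have : Module.Finite A M := Module.Finite.equiv e.symm
  obtain ⟨f, hf, g, hg, hfg⟩ := exists_isWeaklyRegular_pair_of_exact
    ((LinearMap.ker ε).subtype ∘ₗ e.toLinearMap) ε
    ((LinearMap.ker ε).injective_subtype.comp e.injective)
    (LinearMap.exact_iff.2 (by simp [LinearMap.range_comp]))
    (hmem a (by simp)) (hmem b (by simp)) (isWeaklyRegular_of_flat hrs _)
    (fun n hn => hyE.right_eq_zero_of_smul (hn y hy))
  exact isMaximalCohenMacaulay_of_isWeaklyRegular_pair hdim hf hg hfg

theorem mem_pow_smul_top_of_apply_mem {y : A} (hy : y ∈ maximalIdeal A) (hyE : IsSMulRegular E y)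
    (hL : ∀ᶠ n in Filter.atTop, hilbertSamuel A E (n + 1) =
      hilbertSamuel A E n + hilbertSamuel A E 1) {ε : (Fin d → A) →ₗ[A] E}
    (hε : Function.Surjective ε) {ι : M →ₗ[A] Fin d → A} (hι : Function.Injective ι)
    (hr : LinearMap.range ι = LinearMap.ker ε) {n : ℕ} {m : M}
    (hm : ι m ∈ (maximalIdeal A ^ (n + 1) • ⊤ : Submodule A (Fin d → A))) :
    m ∈ (maximalIdeal A ^ n • ⊤ : Submodule A M) := by
  have h1 := ker_inf_pow_smul_top_le hy hyE hL ε hε n ⟨hr ▸ LinearMap.mem_range_self ι m, hm⟩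
  rw [← hr, LinearMap.range_eq_map, ← Submodule.map_smul''] at h1
  obtain ⟨m', hm', h2⟩ := h1
  rwa [← hι h2]

theorem isGradedCohenMacaulay_of_equiv_ker (hdim : ringKrullDim A = 2)
    (hdepth : 2 ≤ depth (maximalIdeal A) A) (hG : IsGradedCohenMacaulay A (AssocGradedRing A))
    {y : A} (hy : y ∈ maximalIdeal A) (hyE : IsSMulRegular E y)
    (hL : ∀ᶠ n in Filter.atTop, hilbertSamuel A E (n + 1) =
      hilbertSamuel A E n + hilbertSamuel A E 1) (ε : (Fin d → A) →ₗ[A] E)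
    (hε : Function.Surjective ε) (hker : LinearMap.ker ε ≤ maximalIdeal A • ⊤)
    (e : M ≃ₗ[A] LinearMap.ker ε) [Nontrivial M] : IsGradedCohenMacaulay A (AssocGraded A M) := by
  have hdimG := ringKrullDim_assocGradedRing hdim hdepth hG
  have hdepthG : ((2 : ℕ) : ℕ∞) ≤ depth (irrelevant A) (AssocGradedRing A) := by
    have h1 := hG
    rw [IsGradedCohenMacaulay, Module.supportDim_self_eq_ringKrullDim, hdimG] at h1
    exact WithBot.coe_le_coe.1 h1.ge
  obtain ⟨rs, hrs, hmem, hlen⟩ := exists_isWeaklyRegular_of_le_depth hdepthG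
  obtain ⟨a, b, rfl⟩ := List.length_eq_two.1 hlen
  have : Module.Finite A M := Module.Finite.equiv e.symm
  let ι : M →ₗ[A] Fin d → A := (LinearMap.ker ε).subtype ∘ₗ e.toLinearMap
  have hι : Function.Injective ι := (LinearMap.ker ε).injective_subtype.comp e.injective
  have hr : LinearMap.range ι = LinearMap.ker ε := by simp [ι, LinearMap.range_comp]
  have hmap : ∀ n, (maximalIdeal A ^ n • ⊤ : Submodule A (Fin d → A)).map ε =
      maximalIdeal A ^ n • ⊤ := fun n => by
    rw [Submodule.map_smul'', Submodule.map_top, LinearMap.range_eq_top.2 hε]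
  have hsup : ∀ n u, u ∈ LinearMap.range ι ⊔ (maximalIdeal A ^ n • ⊤) ↔
      ε u ∈ (maximalIdeal A ^ n • ⊤ : Submodule A E) := fun n u => by
    rw [← hmap, ← Submodule.mem_comap, Submodule.comap_map_eq, hr, sup_comm]
  obtain ⟨f, hf, g, hg, hfg⟩ := exists_isWeaklyRegular_pair_assocGraded ι
    (fun m => (mem_smul_top_pi_iff _).1 (hker (hr ▸ LinearMap.mem_range_self ι m)))
    (fun n m hm => mem_pow_smul_top_of_apply_mem hy hyE hL hε hι hr
      ((mem_smul_top_pi_iff _).2 hm))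
    (fun n u _ hu => by
      rw [hsup]
      refine mem_pow_smul_top_of_forall_smul_mem hy hyE hL fun c hc => ?_
      rw [← map_smul, ← hsup]
      exact hu c hc)
    (hmem a (by simp)) (hmem b (by simp)) hrs
  exact isGradedCohenMacaulay_of_isWeaklyRegular_pair hdimG hf hg hfg

/-- Lengths are counted in `0 → M/𝔪M → F/𝔪²F → E/𝔪²E → 0`, exact on the left because `M ∩ 𝔪²F = 𝔪M`.
With `m ≤ d` this bounds the embedding dimension by two. -/
theorem isRegularLocalRing_of_free_of_equiv_ker (hdim : ringKrullDim A = 2)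
    {y : A} (hy : y ∈ maximalIdeal A) (hyE : IsSMulRegular E y)
    (hL : ∀ᶠ n in Filter.atTop, hilbertSamuel A E (n + 1) =
      hilbertSamuel A E n + hilbertSamuel A E 1) (ε : (Fin d → A) →ₗ[A] E)
    (hε : Function.Surjective ε) (hker : LinearMap.ker ε ≤ maximalIdeal A • ⊤)
    (e : M ≃ₗ[A] LinearMap.ker ε) [Nontrivial E] [Module.Free A M] : IsRegularLocalRing A := by
  have : Module.Finite A M := Module.Finite.equiv e.symm
  let ι : M →ₗ[A] Fin d → A := (LinearMap.ker ε).subtype ∘ₗ e.toLinearMap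
  have hι : Function.Injective ι := (LinearMap.ker ε).injective_subtype.comp e.injective
  have hr : LinearMap.range ι = LinearMap.ker ε := by simp [ι, LinearMap.range_comp]
  have hmap : ∀ n, (maximalIdeal A ^ n • ⊤ : Submodule A (Fin d → A)).map ε =
      maximalIdeal A ^ n • ⊤ := fun n => by
    rw [Submodule.map_smul'', Submodule.map_top, LinearMap.range_eq_top.2 hε]
  let m := Module.finrank A M
  let b : M ≃ₗ[A] (Fin m → A) := (Module.finBasis A M).equivFun
  have hmd : m ≤ d := le_of_fin_injective A (ι ∘ₗ b.symm.toLinearMap)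
    (hι.comp b.symm.injective)
  have hA1 : hilbertSamuel A A 1 = 1 := by
    rw [hilbertSamuel_self, pow_one, Module.length_eq_one_iff]
    exact isSimpleModule_iff_quot_maximal.2 ⟨_, inferInstance, ⟨.refl _ _⟩⟩
  have hM1 : hilbertSamuel A M 1 = m := by
    rw [hilbertSamuel_congr b, hilbertSamuel_pi, hA1, mul_one]
  have hE1 : hilbertSamuel A E 1 = d := by
    rw [← mul_one (d : ℕ∞), ← hA1, ← hilbertSamuel_pi]
    refine LinearEquiv.length_eq (LinearEquiv.symm ?_)
    refine LinearEquiv.ofBijective (Submodule.mapQ _ _ ε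
      (by rw [← Submodule.map_le_iff_le_comap, hmap])) ⟨?_, ?_⟩
    · rw [← LinearMap.ker_eq_bot, Submodule.ker_mapQ, ← hmap, Submodule.comap_map_eq,
        sup_eq_left.2 (by simpa using hker), Submodule.mkQ_map_self]
    · intro z
      obtain ⟨u, rfl⟩ := Submodule.mkQ_surjective _ z
      obtain ⟨v, rfl⟩ := hε u
      exact ⟨Submodule.mkQ _ v, rfl⟩
  have hle : (maximalIdeal A ^ 1 • ⊤ : Submodule A M) ≤
      (maximalIdeal A ^ 2 • ⊤ : Submodule A (Fin d → A)).comap ι := by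
    rw [← Submodule.map_le_iff_le_comap, Submodule.map_smul'', ← LinearMap.range_eq_map, hr, pow_two,
      Submodule.mul_smul, pow_one]
    exact Submodule.smul_mono le_rfl hker
  have hexact : hilbertSamuel A (Fin d → A) 2 = hilbertSamuel A M 1 + hilbertSamuel A E 2 := by
    refine Module.length_eq_add_of_exact (Submodule.mapQ _ _ ι hle)
      (Submodule.mapQ _ _ ε (by rw [← Submodule.map_le_iff_le_comap, hmap])) ?_ ?_ ?_
    · rw [← LinearMap.ker_eq_bot, Submodule.ker_mapQ, eq_bot_iff, Submodule.map_le_iff_le_comap,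
        Submodule.comap_bot, Submodule.ker_mkQ]
      intro z hz
      exact mem_pow_smul_top_of_apply_mem hy hyE hL hε hι hr hz
    · intro z
      obtain ⟨u, rfl⟩ := Submodule.mkQ_surjective _ z
      obtain ⟨v, rfl⟩ := hε u
      exact ⟨Submodule.mkQ _ v, rfl⟩
    · rw [LinearMap.exact_iff, Submodule.ker_mapQ, Submodule.range_mapQ, ← hmap,
        Submodule.comap_map_eq, hr, Submodule.map_sup, Submodule.mkQ_map_self, bot_sup_eq]
  rw [hilbertSamuel_pi, hM1, hilbertSamuel_two hy hyE hL, hE1, hilbertSamuel_self_two, hA1] at hexact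
  have hnat : d * ((maximalIdeal A).spanFinrank + 1) = m + (d + d) := by exact_mod_cast hexact
  have hd : 0 < d := by
    rw [Nat.pos_iff_ne_zero]
    rintro rfl
    obtain ⟨x, hx⟩ := exists_ne (0 : E)
    obtain ⟨u, rfl⟩ := hε x
    exact hx (by rw [Subsingleton.elim u 0, map_zero])
  refine IsRegularLocalRing.of_spanFinrank_maximalIdeal_le A ?_
  rw [hdim]
  have h2 : (maximalIdeal A).spanFinrank ≤ 2 := by
    refine Nat.le_of_mul_le_mul_left (c := d) ?_ hd
    rw [mul_add, mul_one] at hnat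
    omega
  exact_mod_cast h2

end Syzygy

/-! ### Ulrich modules over one-dimensional quotients and their syzygies. -/

section UlrichSyzygy

theorem IsCohenMacaulayLocalRing.two_le_depth {A : Type*} [CommRing A] [IsCohenMacaulayLocalRing A]
    (hdim : ringKrullDim A = 2) : 2 ≤ depth (maximalIdeal A) A := by
  have h := IsCohenMacaulayLocalRing.depth_eq (A := A)
  rw [hdim] at h
  exact WithBot.coe_le_coe.1 h.ge

/-- First syzygies of Ulrich modules over one-dimensional quotients. -/
theorem IsFirstSyzygy.isMaximalCohenMacaulay_and_isGradedCohenMacaulay {A : Type u} [CommRing A]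
    [IsCohenMacaulayLocalRing A] (hdim : ringKrullDim A = 2)
    (hG : IsGradedCohenMacaulay A (AssocGradedRing A)) (I : Ideal A)
    [IsCohenMacaulayLocalRing (A ⧸ I)] (E : Type u) [AddCommGroup E] [Module A E]
    [Module (A ⧸ I) E] [IsScalarTower A (A ⧸ I) E] (M : Type u) [AddCommGroup M] [Module A M]
    (hI : ringKrullDim (A ⧸ I) = 1) (hE : IsUlrich (A ⧸ I) E) (hM : IsFirstSyzygy A E M) :
    IsMaximalCohenMacaulay A M ∧ IsGradedCohenMacaulay A (AssocGraded A M) ∧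
      (¬ IsRegularLocalRing A → ¬ Module.Free A M) := by
  obtain ⟨d, ε, hε, hker, ⟨e⟩⟩ := hM
  have hsurj : Function.Surjective (algebraMap A (A ⧸ I)) := Ideal.Quotient.mk_surjective
  have := hE.isMaximalCohenMacaulay.finite
  have := hE.isMaximalCohenMacaulay.nontrivial
  have : Module.Finite A E := Module.Finite.of_surjective ε hε
  obtain ⟨⟨y', hy', hyE'⟩, hL'⟩ := IsUlrich.exists_isSMulRegular hI hE
  obtain ⟨y, rfl⟩ := hsurj y'
  have := IsLocalHom.of_surjective (algebraMap A (A ⧸ I)) hsurj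
  have hy : y ∈ maximalIdeal A := by
    rwa [← maximalIdeal_comap (algebraMap A (A ⧸ I)), Ideal.mem_comap]
  have hyE : IsSMulRegular E y := (isSMulRegular_algebraMap_iff (A ⧸ I)).1 hyE'
  have hL : ∀ᶠ n in Filter.atTop, hilbertSamuel A E (n + 1) =
      hilbertSamuel A E n + hilbertSamuel A E 1 := by
    simpa only [hilbertSamuel_eq_of_surjective hsurj (E := E)] using hL'
  -- If `M = 0` then `E` is a nonzero free `A`-module killed by `I`, so `I = 0`, which is
  -- incompatible with the dimensions.
  have hnt : Nontrivial M := by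
    by_contra hM
    rw [not_nontrivial_iff_subsingleton] at hM
    have hinj : LinearMap.ker ε = ⊥ :=
      (Submodule.subsingleton_iff_eq_bot).1 e.symm.toEquiv.subsingleton
    have hI0 : I = ⊥ := by
      rw [eq_bot_iff]
      intro a ha
      obtain ⟨x, hx⟩ := exists_ne (0 : E)
      obtain ⟨u, rfl⟩ := hε x
      have hd : Nonempty (Fin d) := by
        by_contra hd
        rw [not_nonempty_iff] at hd
        exact hx (by rw [Subsingleton.elim u 0, map_zero])
      obtain ⟨i⟩ := hd
      have hmem : a • (Pi.single i 1 : Fin d → A) ∈ LinearMap.ker ε := by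
        rw [LinearMap.mem_ker, map_smul, ← algebraMap_smul (A ⧸ I) a, Ideal.Quotient.algebraMap_eq,
          Ideal.Quotient.eq_zero_iff_mem.2 ha, zero_smul]
      rw [hinj, Submodule.mem_bot] at hmem
      simpa using congrFun hmem i
    subst hI0
    rw [ringKrullDim_eq_of_ringEquiv (RingEquiv.quotientBot A), hdim] at hI
    exact absurd hI (by decide)
  have hdepth := IsCohenMacaulayLocalRing.two_le_depth hdim
  exact ⟨isMaximalCohenMacaulay_of_equiv_ker hdim hdepth hy hyE ε e,
    isGradedCohenMacaulay_of_equiv_ker hdim hdepth hG hy hyE hL ε hε hker e,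
    fun hreg _ => hreg (isRegularLocalRing_of_free_of_equiv_ker hdim hy hyE hL ε hε hker e)⟩

/-- Lifts of a basis of `E/𝔪E` generate `E` by Nakayama, and independence of the basis places the
relations in `𝔪F`. -/
theorem exists_isFirstSyzygy (A : Type u) [CommRing A] [IsLocalRing A] [IsNoetherianRing A]
    (E : Type u) [AddCommGroup E] [Module A E] [Module.Finite A E] :
    ∃ (M : Type u) (_ : AddCommGroup M) (_ : Module A M), IsFirstSyzygy A E M := by
  let _ : Field (A ⧸ maximalIdeal A) := Ideal.Quotient.field _
  let V := E ⧸ (maximalIdeal A • ⊤ : Submodule A E)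
  have : Module.Finite (A ⧸ maximalIdeal A) V := Module.Finite.of_restrictScalars_finite A _ _
  let b := Module.finBasis (A ⧸ maximalIdeal A) V
  choose v hv using fun i => Submodule.mkQ_surjective (maximalIdeal A • ⊤ : Submodule A E) (b i)
  let ε := Fintype.linearCombination A v
  have hε : ∀ u, Submodule.mkQ (maximalIdeal A • ⊤ : Submodule A E) (ε u) =
      ∑ i, (Ideal.Quotient.mk (maximalIdeal A) (u i)) • b i := fun u => by
    simp only [ε, Fintype.linearCombination_apply, map_sum, map_smul, hv]
    rfl
  refine ⟨LinearMap.ker ε, inferInstance, inferInstance, _, ε, ?_, ?_, ⟨.refl _ _⟩⟩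
  · rw [← LinearMap.range_eq_top, ← IsLocalRing.map_mkQ_eq_top, eq_top_iff]
    intro z _
    choose u hu using fun i => Ideal.Quotient.mk_surjective (b.repr z i)
    refine ⟨ε u, LinearMap.mem_range_self _ _, ?_⟩
    rw [hε]
    simp only [hu]
    exact b.sum_repr z
  · intro u hu
    rw [mem_smul_top_pi_iff]
    have h1 := hε u
    rw [LinearMap.mem_ker.1 hu, map_zero] at h1
    intro i
    exact Ideal.Quotient.eq_zero_iff_mem.1
      (Fintype.linearIndependent_iff.1 b.linearIndependent _ h1.symm i)

section OneDimensional

variable {B : Type u} [CommRing B] [IsLocalRing B] [IsNoetherianRing B]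

theorem supportDim_eq_one_and_depth_eq_one (hB : ringKrullDim B = 1) {E : Type*} [AddCommGroup E]
    [Module B E] [Module.Finite B E] [Nontrivial E] {y : B} (hy : y ∈ maximalIdeal B)
    (hyE : IsSMulRegular E y) : Module.supportDim B E = 1 ∧ depth (maximalIdeal B) E = 1 := by
  have hmem : ∀ r ∈ [y], r ∈ maximalIdeal B := by simpa using hy
  have h1 : 1 ≤ depth (maximalIdeal B) E := by
    have := le_depth_of_isRegular ((isRegular_iff_isWeaklyRegular_of_subset_maximalIdeal hmem).2
      ((isWeaklyRegular_singleton_iff _ _).2 hyE)) hmem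
    exact_mod_cast this
  have h2 := depth_le_supportDim (N := E) (maximalIdeal B)
  have h3 := Module.supportDim_le_ringKrullDim B E
  rw [hB] at h3
  have h1' : (1 : WithBot ℕ∞) ≤ depth (maximalIdeal B) E := by exact_mod_cast h1
  refine ⟨le_antisymm h3 (h1'.trans h2), le_antisymm ?_ h1⟩
  exact_mod_cast h2.trans h3

/-- Large powers of the maximal ideal of a one-dimensional Cohen-Macaulay local ring are Ulrich. -/
theorem exists_isUlrich_maximalIdeal_pow (hB : ringKrullDim B = 1) {y : B}
    (hy : y ∈ maximalIdeal B) (hyB : IsSMulRegular B y) :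
    ∃ c : ℕ, IsUlrich B (maximalIdeal B ^ c : Ideal B) := by
  have hrange : LinearMap.range (LinearMap.lsmul B B y) = Ideal.span {y} := by
    ext z
    simp [Ideal.mem_span_singleton', mul_comm]
  have hfin : Module.length B (B ⧸ LinearMap.range (LinearMap.lsmul B B y)) ≠ ⊤ := by
    have hdim0 := ringKrullDim_quotient_span_singleton_succ_eq_ringKrullDim hyB hy
    have : IsArtinianRing (B ⧸ Ideal.span {y}) := by
      rw [isArtinianRing_iff_krullDimLE_zero, Ring.krullDimLE_iff]
      exact ENat.WithBot.add_le_add_one_right_iff.1 (by rw [hdim0, hB]; rfl)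
    rw [hrange, Module.length_eq_of_surjective (R := B ⧸ Ideal.span {y})
      Ideal.Quotient.mk_surjective]
    exact Module.length_ne_top
  obtain ⟨e, he⟩ := exists_eventually_hilbertSamuel_succ hy hyB hfin
  obtain ⟨c, hc⟩ := Filter.eventually_atTop.1 he
  -- From exponent `c` on the increments are all `e`; subtracting `ℓ(B/𝔪ᶜ)` leaves `ℓ(𝔪ᶜ/𝔪ᶜ⁺ᵏ) =
  -- k·e` for every `k`, not only for large `k`.
  have hadd : ∀ k, hilbertSamuel B B (c + k) = k * e + hilbertSamuel B B c := by
    intro k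
    induction k with
    | zero => simp
    | succ k ih =>
      rw [← add_assoc, hc _ (by omega), ih]
      push_cast
      ring
  let E : Ideal B := maximalIdeal B ^ c
  have hE : ∀ k, hilbertSamuel B E k = k * e := fun k =>
    (ENat.addLECancellable_of_ne_top (hilbertSamuel_ne_top c)).inj_left.1
      ((hilbertSamuel_self_add c k).symm.trans (hadd k))
  have hy0 : y ^ c ≠ 0 := fun h0 => one_ne_zero (α := B)
    ((hyB.pow c).right_eq_zero_of_smul (by simp [h0]))
  have : Nontrivial E := ⟨⟨⟨y ^ c, Ideal.pow_mem_pow hy c⟩, 0, fun h => hy0 (congrArg Subtype.val h)⟩⟩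
  have hyE : IsSMulRegular E y := hyB.submodule E y
  obtain ⟨hsupp, hdepth⟩ := supportDim_eq_one_and_depth_eq_one hB hy hyE
  have he1 : e = (⊤ : Submodule B E).spanFinrank := by
    rw [← hilbertSamuel_one_eq_spanFinrank, hE]
    simp
  have hμ : (⊤ : Submodule B E).spanFinrank ≠ 0 := by
    intro h0
    have h1 : hilbertSamuel B E 1 = 0 := by rw [hilbertSamuel_one_eq_spanFinrank, h0]; rfl
    rw [hilbertSamuel, Module.length_eq_zero_iff, Submodule.Quotient.subsingleton_iff,
      pow_one] at h1
    exact Submodule.top_ne_ideal_smul_of_le_jacobson_annihilator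
      (IsLocalRing.maximalIdeal_le_jacobson _) h1.symm
  set μ := (⊤ : Submodule B E).spanFinrank
  have hμ' : (μ : ℚ) ≠ 0 := by exact_mod_cast hμ
  -- The polynomial is `μ(X + 1)`, since its value at `n` is the length modulo `𝔪ⁿ⁺¹`.
  refine ⟨c, ⟨inferInstance, inferInstance, ?_⟩, 1,
    Polynomial.C (μ : ℚ) * Polynomial.X + Polynomial.C (μ : ℚ), ?_, ?_, ?_, ?_⟩
  · rw [hB, hdepth]; rfl
  · rw [hsupp]; rfl
  · refine Filter.Eventually.of_forall fun n => ⟨(n + 1) * μ, ?_, ?_⟩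
    · have := hE (n + 1)
      rw [he1] at this
      exact_mod_cast this
    · simp
      ring
  · exact Polynomial.natDegree_linear hμ'
  · rw [Polynomial.leadingCoeff_linear hμ']
    simp [μ, E]

end OneDimensional

theorem exists_isUlrich_quotient {A : Type u} [CommRing A]
    [IsCohenMacaulayLocalRing A] (hdim : ringKrullDim A = 2) :
    ∃ (I : Ideal A) (_ : IsCohenMacaulayLocalRing (A ⧸ I)) (J : Ideal (A ⧸ I)),
      ringKrullDim (A ⧸ I) = 1 ∧ IsUlrich (A ⧸ I) J := by
  obtain ⟨rs, hrs, hmem, hlen⟩ := exists_isWeaklyRegular_of_le_depth (n := 2)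
    (IsCohenMacaulayLocalRing.two_le_depth hdim)
  obtain ⟨x, y, rfl⟩ := List.length_eq_two.1 hlen
  have hx := hmem x (by simp)
  have hy := hmem y (by simp)
  obtain ⟨hxA, hyB⟩ := isWeaklyRegular_pair_iff.1 hrs
  let B := A ⧸ Ideal.span {x}
  have hsurj : Function.Surjective (algebraMap A B) := Ideal.Quotient.mk_surjective
  have : Nontrivial B := Ideal.Quotient.nontrivial_iff.2 (ne_top_of_le_ne_top
    (maximalIdeal.isMaximal A).ne_top ((Ideal.span_singleton_le_iff_mem _).2 hx))
  have : IsLocalRing B := .of_surjective' (Ideal.Quotient.mk _) Ideal.Quotient.mk_surjective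
  have hB : ringKrullDim B = 1 := by
    have h := ringKrullDim_quotient_span_singleton_succ_eq_ringKrullDim hxA hx
    rw [hdim] at h
    exact ENat.WithBot.add_one_cancel.1 (h.trans (by rfl))
  have := IsLocalHom.of_surjective (algebraMap A B) hsurj
  have hyB' : IsSMulRegular B (algebraMap A B y) := (isSMulRegular_algebraMap_iff B).2 hyB
  have hy' : algebraMap A B y ∈ maximalIdeal B := by
    rwa [← Ideal.mem_comap, maximalIdeal_comap]
  obtain ⟨c, hc⟩ := exists_isUlrich_maximalIdeal_pow hB hy' hyB'
  have hCM : IsCohenMacaulayLocalRing B := by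
    refine { depth_eq := ?_ }
    rw [(supportDim_eq_one_and_depth_eq_one hB hy' hyB').2, hB]
    rfl
  exact ⟨Ideal.span {x}, hCM, _, hB, hc⟩

end UlrichSyzygy

end GradedCM

end

open GradedCM in
theorem theorem9 (A : Type u) [CommRing A] [IsCohenMacaulayLocalRing A]
    (hdim : ringKrullDim A = 2) (hG : IsGradedCohenMacaulay A (AssocGradedRing A)) :
    (∃ (I : Ideal A) (_ : IsCohenMacaulayLocalRing (A ⧸ I))
      (E : Type u) (_ : AddCommGroup E) (_ : Module A E) (_ : Module (A ⧸ I) E)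
      (_ : IsScalarTower A (A ⧸ I) E)
      (M : Type u) (_ : AddCommGroup M) (_ : Module A M),
      ringKrullDim (A ⧸ I) = 1 ∧ IsUlrich (A ⧸ I) E ∧ IsFirstSyzygy A E M ∧
      IsMaximalCohenMacaulay A M ∧ IsGradedCohenMacaulay A (AssocGraded A M) ∧
      (¬ IsRegularLocalRing A → ¬ Module.Free A M)) ∧
    (∀ (I : Ideal A) [IsCohenMacaulayLocalRing (A ⧸ I)]
      (E : Type u) [AddCommGroup E] [Module A E] [Module (A ⧸ I) E] [IsScalarTower A (A ⧸ I) E]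
      (M : Type u) [AddCommGroup M] [Module A M],
      ringKrullDim (A ⧸ I) = 1 → IsUlrich (A ⧸ I) E → IsFirstSyzygy A E M →
      IsMaximalCohenMacaulay A M ∧ IsGradedCohenMacaulay A (AssocGraded A M) ∧
      (¬ IsRegularLocalRing A → ¬ Module.Free A M)) := by
  refine ⟨?_, fun I _ E _ _ _ _ M _ _ =>
    IsFirstSyzygy.isMaximalCohenMacaulay_and_isGradedCohenMacaulay hdim hG I E M⟩
  obtain ⟨I, hI, J, hI1, hJ⟩ := exists_isUlrich_quotient hdim
  have : Module.Finite (A ⧸ I) J := hJ.isMaximalCohenMacaulay.finite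
  have : Module.Finite A J := Module.Finite.trans (A ⧸ I) J
  obtain ⟨M, _, _, hM⟩ := exists_isFirstSyzygy A J
  exact ⟨I, hI, J, inferInstance, inferInstance, inferInstance, inferInstance, M, inferInstance,
    inferInstance, hI1, hJ, hM, IsFirstSyzygy.isMaximalCohenMacaulay_and_isGradedCohenMacaulay
      hdim hG I J M hI1 hJ hM⟩
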